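/- Let $G$ be a finite abelian group with neutral element $e$ and let $\widehat G$ be its group of characters, with trivial character $\iota$. Orient the bonds of the square lattice $\mathbb Z^2$ to the right and upwards, attach to each bond a copy of $\mathbb C^{|G|}$ with orthonormal basis $\{|g\rangle : g\in G\}$, and let $\mathcal A=\overline{\bigcup_\Lambda \mathcal A_\Lambda}$ be the quasi-local $C^*$-algebra, where $\mathcal A_\Lambda$ is the full matrix algebra of a finite set $\Lambda$ of bonds. For a vertex $v$ let $A_v^g$ be the gauge transformation by $g$ at $v$ (it maps the label $c$ of each bond that leaves $v$ to $gc$ and of each bond that enters $v$ to $cg^{-1}$), and for a face $f$ let $B_f^h$ be the projection onto the configurations whose clockwise product around $f$ is $h$. Put $A_v=\frac1{|G|}\sum_g A_v^g$ and $B_f=B_f^e$. Let $\Lambda_L$ be the set of bonds in $[-L,L]^2$, let $\mathcal V_L$ and $\mathcal F_L$ be the sets of vertices and faces all of whose four bonds lie in $\Lambda_L$, and let $$H_L=\sum_{v\in\mathcal V_L}(I-A_v)+\sum_{f\in\mathcal F_L}(I-B_f).$$ Let $\delta$ be the closure of the operator $A\mapsto\lim_{L\to\infty}[H_L,A]$ on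 local observables. An infinite-volume ground state is a state $\omega$ on $\mathcal A$ with $\omega(A^*\delta(A))\ge 0$ for all $A$ in the domain of $\delta$. With $D_v^\chi=\frac1{|G|}\sum_{g}\overline{\chi(g)}A_v^g$, let $$D_L^\chi=\sum_{\prod_v\chi_v=\chi}\ \prod_{v\in\mathcal V_L}D_v^{\chi_v},\qquad D_L^c=\sum_{\prod_f c_f=c}\ \prod_{f\in\mathcal F_L}B_f^{c_f},\qquad D_L^\epsilon=\sum_{\chi\ne\iota}D_L^\chi,\qquad D_L^\mu=\sum_{c\neq e}D_L^c$$ be the projections onto given, respectively nontrivial, total electric and magnetic charge in $\Lambda_L$. For a ribbon $\rho$ (a sequence of adjacent sites, a site being a pair of a vertex and a neighbouring face) let $F_\rho^{h,g}$ be Kitaev's ribbon operator, and let $F_\rho^{\chi,c}=\sum_{g\in G}\overline{\chi(g)}F_\rho^{c^{-1},g}$. Let $\partial L$ be the closed ribbon along the boundary of $\Lambda_L$, through the sites $(v,f)$ with $v$ on the boundary of the square $[-L,L]^2$ and $f\in\mathcal F_L$, and let $$V_L^\epsilon=\frac1{|G|}\sum_{c\in G}\bigl(I-F_{\partial L}^{\iota,c}\bigr),\qquad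 V_L^\mu=\frac1{|G|}\sum_{\chi\in\widehat G}\bigl(I-F_{\partial L}^{\chi,e}\bigr).$$ Then: 1. A state $\omega$ on $\mathcal A$ is an infinite-volume ground state if and only if $\omega(H_L-D_L^\epsilon-D_L^\mu)=0$ for all $L\ge 2$. 2. For all $L\ge2$, $D_L^\epsilon=V_L^\epsilon$ and $D_L^\mu=V_L^\mu$, and these operators lie in $\mathcal A_{\Lambda_L\setminus\Lambda_{L-1}}$. 3. Consequently, for all $L\ge2$ the finite-volume Hamiltonian $H_L^{\epsilon,\mu}:=H_L-V_L^\epsilon-V_L^\mu$ is a positive element of $\mathcal A_{\Lambda_L}$, and every infinite-volume ground state restricts to a state on $\mathcal A_{\Lambda_L}$ with $\omega(H_L^{\epsilon,\mu})=0$. -/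

import Mathlib

open Filter Topology
open scoped ComplexOrder

noncomputable section

namespace QuantumDouble

/-! ### The square lattice -/

/-- The direction of a bond: every bond points right or up. -/
inductive Dir
  | right
  | up
  deriving DecidableEq

/-- An oriented bond (edge) of the square lattice `ℤ²`, given by its initial vertex and its
direction. -/
structure Bond where
  src : ℤ × ℤ
  dir : Dir
  deriving DecidableEq

/-- The final vertex of a bond. -/
def Bond.tgt (x : Bond) : ℤ × ℤ :=
  match x.dir with
  | .right => (x.src.1 + 1, x.src.2)
  | .up => (x.src.1, x.src.2 + 1)

/-- The star of a vertex: the four bonds that contain it. -/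
def starBonds (v : ℤ × ℤ) : Finset Bond :=
  {⟨v, .right⟩, ⟨v, .up⟩, ⟨(v.1 - 1, v.2), .right⟩, ⟨(v.1, v.2 - 1), .up⟩}

/-- Faces are labelled by their lower left corner. The four sides of a face. -/
def leftSide (f : ℤ × ℤ) : Bond := ⟨f, .up⟩
def topSide (f : ℤ × ℤ) : Bond := ⟨(f.1, f.2 + 1), .right⟩
def rightSide (f : ℤ × ℤ) : Bond := ⟨(f.1 + 1, f.2), .up⟩
def bottomSide (f : ℤ × ℤ) : Bond := ⟨f, .right⟩

/-- The plaquette of a face: its four sides. -/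
def plaquette (f : ℤ × ℤ) : Finset Bond :=
  {leftSide f, topSide f, rightSide f, bottomSide f}

/-- `Λ_L`: all bonds contained in the square `[-L, L]²`. -/
def box (L : ℕ) : Finset Bond :=
  ((Finset.Icc (-(L : ℤ)) L ×ˢ Finset.Icc (-(L : ℤ)) L) ×ˢ {Dir.right, Dir.up}).image
      (fun p => Bond.mk p.1 p.2) |>.filter
    (fun x => x.tgt ∈ Finset.Icc (-(L : ℤ)) L ×ˢ Finset.Icc (-(L : ℤ)) L)

/-- The vertices whose star is contained in `Λ`. -/
def starsIn (Λ : Finset Bond) : Finset (ℤ × ℤ) :=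
  (Λ.image Bond.src).filter (fun v => starBonds v ⊆ Λ)

/-- The faces whose plaquette is contained in `Λ`. -/
def facesIn (Λ : Finset Bond) : Finset (ℤ × ℤ) :=
  (Λ.image Bond.src).filter (fun f => plaquette f ⊆ Λ)

/-! ### The quasi-local algebra

The matrix algebra `M_{|G|^|Λ|}(ℂ)` of a finite set `Λ` of bonds is
`Matrix (Λ → G) (Λ → G) ℂ`: the basis of the local Hilbert space is labelled by the maps
`Λ → G`. All these algebras are represented, compatibly with the inclusions `A ↦ A ⊗ I`, on
`ℓ²(Bond → G)`; the representation `localRep` is an injective (hence isometric) unital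
`*`-homomorphism on each of them, so that the norm closure of the union of the images is the
quasi-local algebra. -/

section Algebra

variable {G : Type*}

/-- The map that agrees with `b` on `Λ` and with `σ` elsewhere. -/
def override (Λ : Finset Bond) (b : Λ → G) (σ : Bond → G) : Bond → G :=
  fun x => if h : x ∈ Λ then b ⟨x, h⟩ else σ x

/-- Restriction of a map to `Λ`. -/
def restr (Λ : Finset Bond) (σ : Bond → G) : Λ → G := fun x => σ x

@[simp] theorem restr_override (Λ : Finset Bond) (b : Λ → G) (σ : Bond → G) :
    restr Λ (override Λ b σ) = b := by
  funext x; simp [restr, override]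

@[simp] theorem override_override (Λ : Finset Bond) (a b : Λ → G) (σ : Bond → G) :
    override Λ a (override Λ b σ) = override Λ a σ := by
  funext x; by_cases h : x ∈ Λ <;> simp [override, h]

@[simp] theorem override_restr (Λ : Finset Bond) (σ : Bond → G) :
    override Λ (restr Λ σ) σ = σ := by
  funext x; simp [restr, override]

variable (G) in
/-- The Hilbert space `ℓ²(Bond → G)`. -/
abbrev HSpace : Type _ := lp (fun _ : Bond → G => ℂ) 2

variable [DecidableEq G]

theorem unit_sum_le (Λ : Finset Bond) (a b : Λ → G) (ψ : HSpace G) (s : Finset (Bond → G)) :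
    ∑ σ ∈ s, ‖(if restr Λ σ = a then ψ (override Λ b σ) else 0 : ℂ)‖ ^ (2 : ENNReal).toReal
      ≤ ‖ψ‖ ^ (2 : ENNReal).toReal := by
  classical
  have h1 : ∑ σ ∈ s, ‖(if restr Λ σ = a then ψ (override Λ b σ) else 0 : ℂ)‖
        ^ (2 : ENNReal).toReal
      = ∑ σ ∈ s with restr Λ σ = a, ‖ψ (override Λ b σ)‖ ^ (2 : ENNReal).toReal := by
    rw [Finset.sum_filter]
    refine Finset.sum_congr rfl fun σ _ => ?_
    split_ifs <;> simp
  have hinj : Set.InjOn (override Λ b) ({σ ∈ s | restr Λ σ = a} : Finset (Bond → G)) := by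
    intro σ hσ τ hτ h
    have hσ' := (Finset.mem_filter.1 (Finset.mem_coe.1 hσ)).2
    have hτ' := (Finset.mem_filter.1 (Finset.mem_coe.1 hτ)).2
    have := congrArg (override Λ a) h
    rw [override_override, override_override] at this
    conv_lhs at this => rw [← hσ', override_restr]
    rwa [← hτ', override_restr] at this
  rw [h1, ← Finset.sum_image (f := fun σ => ‖ψ σ‖ ^ (2 : ENNReal).toReal) hinj]
  exact lp.sum_rpow_le_norm_rpow (by simp) ψ _

/-- The matrix unit `|a⟩⟨b|` on `Λ`, acting on `ℓ²(Bond → G)`. -/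
def matUnit (Λ : Finset Bond) (a b : Λ → G) : HSpace G →L[ℂ] HSpace G :=
  LinearMap.mkContinuous
    { toFun := fun ψ => ⟨fun σ => if restr Λ σ = a then ψ (override Λ b σ) else 0,
        memℓp_gen' (unit_sum_le Λ a b ψ)⟩
      map_add' := fun ψ φ => by
        ext σ; simp only [lp.coeFn_add, Pi.add_apply]; split_ifs <;> simp
      map_smul' := fun c ψ => by
        ext σ; simp only [lp.coeFn_smul, Pi.smul_apply]; split_ifs <;> simp }
    1 (fun ψ => by
      rw [one_mul]
      exact lp.norm_le_of_forall_sum_le (by simp) (norm_nonneg _) (unit_sum_le Λ a b ψ))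

theorem matUnit_apply (Λ : Finset Bond) (a b : Λ → G) (ψ : HSpace G) (σ : Bond → G) :
    matUnit Λ a b ψ σ = if restr Λ σ = a then ψ (override Λ b σ) else 0 := rfl

theorem matUnit_inner (Λ : Finset Bond) (a b : Λ → G) (φ ψ : HSpace G) :
    inner ℂ (matUnit Λ a b φ) ψ = inner ℂ φ (matUnit Λ b a ψ) := by
  classical
  rw [lp.inner_eq_tsum, lp.inner_eq_tsum]
  let s : (Bond → G) → (Bond → G) := fun σ =>
    if restr Λ σ = a then override Λ b σ
    else if restr Λ σ = b then override Λ a σ else σ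
  have hs : Function.Involutive s := by
    intro σ
    by_cases h1 : restr Λ σ = a
    · have e1 : s σ = override Λ b σ := by simp [s, h1]
      rw [e1]
      by_cases hab : b = a
      · subst hab
        simp only [s, restr_override, if_true, override_override]
        rw [← h1, override_restr]
      · simp only [s, restr_override, if_neg hab, if_true, override_override]
        rw [← h1, override_restr]
    · by_cases h2 : restr Λ σ = b
      · have e1 : s σ = override Λ a σ := by simp only [s, if_neg h1, if_pos h2]
        rw [e1]
        simp only [s, restr_override, if_true, override_override]
        rw [← h2, override_restr]
      · simp only [s, if_neg h1, if_neg h2]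
  rw [← (hs.toPerm s).tsum_eq]
  refine tsum_congr fun σ => ?_
  simp only [Function.Involutive.coe_toPerm, matUnit_apply]
  by_cases h1 : restr Λ σ = b
  · have e1 : s σ = override Λ a σ := by
      by_cases h2 : restr Λ σ = a
      · have hab : b = a := h1.symm.trans h2
        simp [s, h2, hab]
      · simp only [s, if_neg h2, if_pos h1]
    rw [e1]
    simp only [restr_override, if_true, override_override, if_pos h1]
    rw [← h1, override_restr]
  · rw [if_neg h1]
    by_cases h2 : restr Λ σ = a
    · have e1 : s σ = override Λ b σ := by simp [s, h2]
      have hab : b ≠ a := fun h => h1 (h2.trans h.symm)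
      rw [e1]; simp [hab]
    · have e1 : s σ = σ := by simp only [s, if_neg h1, if_neg h2]
      rw [e1]; simp [h2]

variable [Fintype G]

/-- The operator on `ℓ²(Bond → G)` given by a matrix of the finite volume `Λ`. -/
def localOp (Λ : Finset Bond) (M : Matrix (Λ → G) (Λ → G) ℂ) : HSpace G →L[ℂ] HSpace G :=
  ∑ a, ∑ b, M a b • matUnit Λ a b

theorem localOp_apply (Λ : Finset Bond) (M : Matrix (Λ → G) (Λ → G) ℂ) (ψ : HSpace G)
    (σ : Bond → G) :
    localOp Λ M ψ σ = ∑ b, M (restr Λ σ) b * ψ (override Λ b σ) := by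
  have h : localOp Λ M ψ σ = ∑ a, ∑ b, M a b * matUnit Λ a b ψ σ := by
    simp only [localOp, _root_.sum_apply, _root_.smul_apply,
      lp.coeFn_sum, Finset.sum_apply, lp.coeFn_smul, Pi.smul_apply, smul_eq_mul]
  rw [h, Finset.sum_comm]
  refine Finset.sum_congr rfl fun b _ => ?_
  simp [matUnit_apply]

/-- The representation of the finite volume matrix algebra on `ℓ²(Bond → G)`. -/
def localRep (Λ : Finset Bond) :
    Matrix (Λ → G) (Λ → G) ℂ →⋆ₐ[ℂ] (HSpace G →L[ℂ] HSpace G) where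
  toFun := localOp Λ
  map_one' := by
    ext ψ σ
    rw [localOp_apply]
    simp [Matrix.one_apply]
  map_mul' M N := by
    ext ψ σ
    rw [mul_apply_eq_comp, localOp_apply, localOp_apply]
    simp only [localOp_apply, restr_override, override_override, Matrix.mul_apply,
      Finset.sum_mul, Finset.mul_sum]
    rw [Finset.sum_comm]
    simp only [mul_assoc]
  map_zero' := by
    ext ψ σ
    rw [localOp_apply]; simp
  map_add' M N := by
    ext ψ σ
    simp only [localOp_apply, _root_.add_apply, lp.coeFn_add, Pi.add_apply,
      Matrix.add_apply, add_mul, Finset.sum_add_distrib]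
  commutes' c := by
    ext ψ σ
    rw [localOp_apply]
    simp [Matrix.algebraMap_matrix_apply, Algebra.algebraMap_eq_smul_one]
  map_star' M := by
    rw [ContinuousLinearMap.star_eq_adjoint]
    refine (ContinuousLinearMap.eq_adjoint_iff _ _).2 fun φ ψ => ?_
    simp only [localOp, _root_.sum_apply, _root_.smul_apply,
      sum_inner, inner_sum, inner_smul_left, inner_smul_right, matUnit_inner,
      Matrix.star_apply]
    rw [Finset.sum_comm]
    simp

theorem localRep_apply (Λ : Finset Bond) (M : Matrix (Λ → G) (Λ → G) ℂ) (ψ : HSpace G)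
    (σ : Bond → G) :
    localRep Λ M ψ σ = ∑ b, M (restr Λ σ) b * ψ (override Λ b σ) :=
  localOp_apply Λ M ψ σ

theorem localRep_injective [Nonempty G] (Λ : Finset Bond) :
    Function.Injective (localRep (G := G) Λ) := by
  classical
  intro M N h
  ext a b
  obtain ⟨g⟩ := ‹Nonempty G›
  let σ : Bond → G := override Λ a fun _ => g
  have key : ∀ P : Matrix (Λ → G) (Λ → G) ℂ,
      localRep Λ P (lp.single 2 (override Λ b σ) (1 : ℂ)) σ = P a b := by
    intro P
    rw [localRep_apply]
    have hσ : restr Λ σ = a := restr_override Λ a _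
    rw [Finset.sum_eq_single b]
    · rw [lp.single_apply_self, hσ, mul_one]
    · intro c _ hc
      rw [lp.single_apply_ne, mul_zero]
      intro hcb
      have := congrArg (restr Λ) hcb
      simp only [restr_override] at this
      exact hc this
    · simp
  rw [← key M, ← key N, h]

/-- The inclusion `A ↦ A ⊗ I` of the matrix algebra of `Λ₁` into the matrix algebra of
`Λ₂ ⊇ Λ₁`. -/
def inclMat {Λ₁ Λ₂ : Finset Bond} (h : Λ₁ ⊆ Λ₂) (M : Matrix (Λ₁ → G) (Λ₁ → G) ℂ) :
    Matrix (Λ₂ → G) (Λ₂ → G) ℂ :=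
  fun a b => if ∀ x : Λ₂, x.1 ∉ Λ₁ → a x = b x then
    M (fun x => a ⟨x.1, h x.2⟩) (fun x => b ⟨x.1, h x.2⟩) else 0

theorem localRep_inclMat {Λ₁ Λ₂ : Finset Bond} (h : Λ₁ ⊆ Λ₂)
    (M : Matrix (Λ₁ → G) (Λ₁ → G) ℂ) :
    localRep Λ₂ (inclMat h M) = localRep Λ₁ M := by
  classical
  ext ψ σ
  rw [localRep_apply, localRep_apply]
  have hinj : Function.Injective
      (fun b : Λ₁ → G => restr Λ₂ (override Λ₁ b σ)) := by
    intro b c hbc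
    funext x
    have := congrFun hbc ⟨x.1, h x.2⟩
    simpa [restr, override] using this
  have h0 : ∀ c : Λ₂ → G, c ∉ Finset.univ.image
      (fun b : Λ₁ → G => restr Λ₂ (override Λ₁ b σ)) →
      inclMat h M (restr Λ₂ σ) c * ψ (override Λ₂ c σ) = 0 := by
    intro c hc
    rw [inclMat, if_neg, zero_mul]
    intro hall
    apply hc
    refine Finset.mem_image.2 ⟨fun x => c ⟨x.1, h x.2⟩, Finset.mem_univ _, ?_⟩
    funext x
    by_cases hx : x.1 ∈ Λ₁
    · simp [restr, override, hx]
    · have := hall x hx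
      simpa [restr, override, hx] using this
  rw [← Finset.sum_subset (Finset.subset_univ _) (fun c _ hc => h0 c hc),
    Finset.sum_image hinj.injOn]
  refine Finset.sum_congr rfl fun b _ => ?_
  congr 1
  · rw [inclMat, if_pos]
    · congr 1
      funext x
      simp [restr, override]
    · intro x hx
      simp [restr, override, hx]
  · have e : override Λ₂ (restr Λ₂ (override Λ₁ b σ)) σ = override Λ₁ b σ := by
      funext x
      by_cases hx : x ∈ Λ₁
      · simp [restr, override, hx, h hx]
      · by_cases hx2 : x ∈ Λ₂ <;> simp [restr, override, hx, hx2]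
    rw [e]

variable (G) in
/-- The algebra of local observables `⋃_Λ A_Λ`, as operators on `ℓ²(Bond → G)`. -/
def locAlg : StarSubalgebra ℂ (HSpace G →L[ℂ] HSpace G) where
  carrier := {T | ∃ Λ M, localRep (G := G) Λ M = T}
  mul_mem' := by
    rintro _ _ ⟨Λ₁, M, rfl⟩ ⟨Λ₂, N, rfl⟩
    refine ⟨Λ₁ ∪ Λ₂, inclMat Finset.subset_union_left M * inclMat Finset.subset_union_right N, ?_⟩
    rw [map_mul, localRep_inclMat, localRep_inclMat]
  add_mem' := by
    rintro _ _ ⟨Λ₁, M, rfl⟩ ⟨Λ₂, N, rfl⟩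
    refine ⟨Λ₁ ∪ Λ₂, inclMat Finset.subset_union_left M + inclMat Finset.subset_union_right N, ?_⟩
    rw [map_add, localRep_inclMat, localRep_inclMat]
  algebraMap_mem' c := ⟨∅, algebraMap ℂ _ c, AlgHomClass.commutes _ c⟩
  star_mem' := by
    rintro _ ⟨Λ, M, rfl⟩
    exact ⟨Λ, star M, map_star _ _⟩

variable (G) in
/-- The quasi-local C*-algebra: the norm closure of the algebra of local observables. -/
def quasiLocal : StarSubalgebra ℂ (HSpace G →L[ℂ] HSpace G) :=
  (locAlg G).topologicalClosure

instance isClosed_quasiLocal :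
    IsClosed (quasiLocal G : Set (HSpace G →L[ℂ] HSpace G)) :=
  (locAlg G).isClosed_topologicalClosure

variable (G) in
/-- The quasi-local C*-algebra as a type. -/
def QLA : Type _ := quasiLocal G

instance : CStarAlgebra (QLA G) := inferInstanceAs (CStarAlgebra (quasiLocal G))

/-- The inclusion of the matrix algebra of a finite volume into the quasi-local algebra. -/
def obs (Λ : Finset Bond) : Matrix (Λ → G) (Λ → G) ℂ →⋆ₐ[ℂ] QLA G :=
  let F : Matrix (Λ → G) (Λ → G) ℂ →⋆ₐ[ℂ] quasiLocal G :=
    (localRep Λ).codRestrict (quasiLocal G)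
      (fun M => (locAlg G).le_topologicalClosure
        (show localRep Λ M ∈ locAlg G from ⟨Λ, M, rfl⟩))
  F

variable (G) in
/-- The local algebra `A_Λ` as a subalgebra of the quasi-local algebra. -/
def localAlg (Λ : Finset Bond) : StarSubalgebra ℂ (QLA G) := (obs (G := G) Λ).range

theorem obs_injective [Nonempty G] (Λ : Finset Bond) : Function.Injective (obs (G := G) Λ) :=
  fun _ _ h => localRep_injective Λ (congrArg Subtype.val h)

theorem obs_inclMat {Λ₁ Λ₂ : Finset Bond} (h : Λ₁ ⊆ Λ₂) (M : Matrix (Λ₁ → G) (Λ₁ → G) ℂ) :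
    obs Λ₂ (inclMat h M) = obs Λ₁ M :=
  Subtype.ext (localRep_inclMat h M)

end Algebra

/-! ### States -/

/-- An element of a `*`-algebra is positive if it has the form `b* b`. -/
def IsPos {A : Type*} [Ring A] [StarRing A] (a : A) : Prop := ∃ b, a = star b * b

/-- A state: a linear functional that is positive and normalized. -/
def IsState {A : Type*} [Ring A] [StarRing A] [Algebra ℂ A] (ω : A →ₗ[ℂ] ℂ) : Prop :=
  (∀ a, IsPos a → 0 ≤ ω a) ∧ ω 1 = 1

/-! ### The quantum double model of a finite abelian group -/

section Model

variable {G : Type*} [CommGroup G] [Fintype G] [DecidableEq G]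

/-- Extension of a map on `Λ` to all bonds by the neutral element. -/
def extend (Λ : Finset Bond) (c : Λ → G) : Bond → G := override Λ c 1

/-- The matrix of the linear map `|c⟩ ↦ |T c⟩` on `Λ`. -/
def moveMat (Λ : Finset Bond) (T : (Bond → G) → (Bond → G)) : Matrix (Λ → G) (Λ → G) ℂ :=
  Matrix.of fun a b => if a = restr Λ (T (extend Λ b)) then 1 else 0

/-- The matrix of the projection onto the span of the `|c⟩` such that `p c` on `Λ`. -/
def projMat (Λ : Finset Bond) (p : (Bond → G) → Prop) [DecidablePred p] :
    Matrix (Λ → G) (Λ → G) ℂ :=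
  Matrix.diagonal fun a => if p (extend Λ a) then 1 else 0

/-- The gauge transformation by `g` at the vertex `v`. -/
def gauge (v : ℤ × ℤ) (g : G) (c : Bond → G) : Bond → G := fun x =>
  if x.src = v then g * c x else if x.tgt = v then c x * g⁻¹ else c x

/-- The product of the values of `c` around the face `f`, clockwise. -/
def monodromy (f : ℤ × ℤ) (c : Bond → G) : G :=
  c (leftSide f) * c (topSide f) * (c (rightSide f))⁻¹ * (c (bottomSide f))⁻¹

/-- The star operator `A_v^g`. -/
def starOp (v : ℤ × ℤ) (g : G) : QLA G := obs (starBonds v) (moveMat (starBonds v) (gauge v g))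

variable (G) in
/-- The interaction term `A_v`. -/
def starTerm (v : ℤ × ℤ) : QLA G := (Fintype.card G : ℂ)⁻¹ • ∑ g : G, starOp v g

/-- The plaquette operator `B_f^h`. -/
def plaqOp (f : ℤ × ℤ) (h : G) : QLA G :=
  obs (plaquette f) (projMat (plaquette f) fun c => monodromy f c = h)

variable (G) in
/-- The interaction term `B_f`. -/
def plaqTerm (f : ℤ × ℤ) : QLA G := plaqOp f 1

variable (G) in
/-- The local Hamiltonian `H_Λ`. -/
def hamiltonian (Λ : Finset Bond) : QLA G :=
  ∑ v ∈ starsIn Λ, (1 - starTerm G v) + ∑ f ∈ facesIn Λ, (1 - plaqTerm G f)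

variable (G) in
/-- The graph of the generator `δ` of the dynamics: the closure of the graph of
`A ↦ lim_L [H_L, A]` on local observables. -/
def generatorGraph : Set (QLA G × QLA G) :=
  closure {p | (∃ Λ, p.1 ∈ localAlg G Λ) ∧
    Tendsto (fun L : ℕ => hamiltonian G (box L) * p.1 - p.1 * hamiltonian G (box L)) atTop
      (𝓝 p.2)}

/-- Infinite-volume ground states: states `ω` with `ω (A* δ(A)) ≥ 0` on the domain of `δ`. -/
def IsGroundState (ω : QLA G →ₗ[ℂ] ℂ) : Prop :=
  IsState ω ∧ ∀ A δA, (A, δA) ∈ generatorGraph G → 0 ≤ ω (star A * δA)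

/-! ### Charge projectors -/

variable (G) in
/-- The group of characters of `G`. -/
abbrev Dual : Type _ := G →* ℂˣ

instance : Fintype (Dual G) := Fintype.ofFinite _

/-- The projector `D_v^χ` onto the electric charge `χ` at the vertex `v`. -/
def elecCharge (v : ℤ × ℤ) (χ : Dual G) : QLA G :=
  (Fintype.card G : ℂ)⁻¹ • ∑ g : G, (starRingEnd ℂ) (χ g : ℂ) • starOp v g

/-- The projector `D_f^c` onto the magnetic charge `c` at the face `f`. -/
def magCharge (f : ℤ × ℤ) (c : G) : QLA G := plaqOp f c

open Classical in
/-- The projector `D_L^χ` onto the total electric charge `χ` in `Λ_L`. The factors of the products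
commute, so that their order does not matter. -/
def totalElec (L : ℕ) (χ : Dual G) : QLA G :=
  ∑ κ : starsIn (box L) → Dual G with ∏ v, κ v = χ,
    ((Finset.univ : Finset (starsIn (box L))).toList.map fun v => elecCharge v.1 (κ v)).prod

/-- The projector `D_L^c` onto the total magnetic charge `c` in `Λ_L`. The factors of the products
commute, so that their order does not matter. -/
def totalMag (L : ℕ) (c : G) : QLA G :=
  ∑ κ : facesIn (box L) → G with ∏ f, κ f = c,
    ((Finset.univ : Finset (facesIn (box L))).toList.map fun f => magCharge f.1 (κ f)).prod

open Classical in
variable (G) in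
/-- The projector `D_L^ε` onto nontrivial total electric charge. -/
def elecBoundary (L : ℕ) : QLA G := ∑ χ : Dual G with χ ≠ 1, totalElec L χ

variable (G) in
/-- The projector `D_L^μ` onto nontrivial total magnetic charge. -/
def magBoundary (L : ℕ) : QLA G := ∑ c : G with c ≠ 1, totalMag L c

/-! ### Ribbons and ribbon operators -/

/-- The face for which the bond is oriented clockwise. -/
def Bond.cwFace (x : Bond) : ℤ × ℤ :=
  match x.dir with
  | .right => (x.src.1, x.src.2 - 1)
  | .up => x.src

/-- The face for which the bond is oriented counterclockwise. -/
def Bond.ccwFace (x : Bond) : ℤ × ℤ :=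
  match x.dir with
  | .right => x.src
  | .up => (x.src.1 - 1, x.src.2)

/-- A triangle is a step between adjacent sites (a site is a pair of a vertex and a face).
* `direct x f fwd`: move along the bond `x`, keeping the face `f`; along the orientation of `x`
  if `fwd` is true, against it otherwise.
* `dual x v fwd`: move across the bond `x`, keeping the vertex `v`; from the face for which `x` is
  counterclockwise to the one for which it is clockwise if `fwd` is true, the other way
  otherwise. -/
inductive Triangle
  | direct (x : Bond) (f : ℤ × ℤ) (fwd : Bool)
  | dual (x : Bond) (v : ℤ × ℤ) (fwd : Bool)
  deriving DecidableEq

namespace Triangle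

/-- The bond of a triangle. -/
def bond : Triangle → Bond
  | direct x _ _ => x
  | dual x _ _ => x

/-- The initial site of a triangle. -/
def start : Triangle → (ℤ × ℤ) × (ℤ × ℤ)
  | direct x f fwd => (if fwd then x.src else x.tgt, f)
  | dual x v fwd => (v, if fwd then x.ccwFace else x.cwFace)

/-- The final site of a triangle. -/
def finish : Triangle → (ℤ × ℤ) × (ℤ × ℤ)
  | direct x f fwd => (if fwd then x.tgt else x.src, f)
  | dual x v fwd => (v, if fwd then x.cwFace else x.ccwFace)

/-- The bond of a direct triangle is a side of its face; the bond of a dual triangle contains its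
vertex. -/
def Valid : Triangle → Prop
  | direct x f _ => x ∈ plaquette f
  | dual x v _ => x ∈ starBonds v

/-- The elementary ribbon operator of a triangle. -/
def op : Triangle → G → G → QLA G
  | direct x _ fwd, _, g => obs {x} (projMat {x} fun c => (if fwd then c x else (c x)⁻¹) = g)
  | dual x _ fwd, h, g =>
    if g = 1 then
      obs {x} (moveMat {x} fun c => Function.update c x ((if fwd then h else h⁻¹) * c x))
    else 0

end Triangle

/-- A closed ribbon: a sequence of at least two triangles that do not cross each other, each
beginning where the one before it ends, and the first beginning where the last ends. -/
def IsClosedRibbon (ρ : List Triangle) : Prop :=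
  2 ≤ ρ.length ∧ (∀ τ ∈ ρ, τ.Valid) ∧ ρ.IsChain (fun τ τ' => τ.finish = τ'.start) ∧
    (ρ.map Triangle.bond).Nodup ∧
    ρ.head?.map Triangle.start = ρ.getLast?.map Triangle.finish

/-- The ribbon operator `F_ρ^{h,g}`, by concatenation of triangles (for an abelian group,
`k⁻¹ h k = h`). -/
def ribbonOp : List Triangle → G → G → QLA G
  | [], _, g => if g = 1 then 1 else 0
  | τ :: ρ, h, g => ∑ k : G, τ.op h k * ribbonOp ρ h (k⁻¹ * g)

/-- The ribbon operator `F_ρ^{χ,c}`. -/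
def chargeRibbonOp (ρ : List Triangle) (χ : Dual G) (c : G) : QLA G :=
  ∑ g : G, (starRingEnd ℂ) (χ g : ℂ) • ribbonOp ρ c⁻¹ g

/-- The closed ribbon `∂L` along the boundary of `Λ_L`: it runs counterclockwise through the sites
`(v, f)` where `v` is on the boundary of the square `[-L, L]²` and `f` is in the square. The four
parts are the bottom, the right, the top and the left side; each consists of the bonds of that
side and of the bonds that leave it at its inner vertices. -/
def boundaryRibbon (L : ℕ) : List Triangle :=
  let l : ℤ := L
  let side (across along : ℤ → Triangle) : List Triangle :=
    (List.range (2 * L)).flatMap fun k => if k = 0 then [along k] else [across k, along k]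
  side (fun k => .dual ⟨(-l + k, -l), .up⟩ (-l + k, -l) true)
      (fun k => .direct ⟨(-l + k, -l), .right⟩ (-l + k, -l) true) ++
    side (fun k => .dual ⟨(l - 1, -l + k), .right⟩ (l, -l + k) false)
      (fun k => .direct ⟨(l, -l + k), .up⟩ (l - 1, -l + k) true) ++
    side (fun k => .dual ⟨(l - k, l - 1), .up⟩ (l - k, l) false)
      (fun k => .direct ⟨(l - k - 1, l), .right⟩ (l - k - 1, l - 1) false) ++
    side (fun k => .dual ⟨(-l, l - k), .right⟩ (-l, l - k) true)
      (fun k => .direct ⟨(-l, l - k - 1), .up⟩ (-l, l - k - 1) false)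

variable (G) in
/-- The boundary operator `V_L^ε`. -/
def elecRibbon (L : ℕ) : QLA G :=
  (Fintype.card G : ℂ)⁻¹ • ∑ c : G, (1 - chargeRibbonOp (boundaryRibbon L) 1 c)

variable (G) in
/-- The boundary operator `V_L^μ`. -/
def magRibbon (L : ℕ) : QLA G :=
  (Fintype.card G : ℂ)⁻¹ • ∑ χ : Dual G, (1 - chargeRibbonOp (boundaryRibbon L) χ 1)

variable (G) in
/-- The Hamiltonian with boundary condition `H_L^{ε,μ} = H_L - V_L^ε - V_L^μ`. -/
def boundaryHamiltonian (L : ℕ) : QLA G :=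
  hamiltonian G (box L) - elecRibbon G L - magRibbon G L

variable (G) in
/-- The zero-energy states of `H_L^{ε,μ}` on `A_{Λ_L}`. -/
def zeroEnergyStates (L : ℕ) : Set (localAlg G (box L) →ₗ[ℂ] ℂ) :=
  {φ | IsState φ ∧ ∀ H : localAlg G (box L), (H : QLA G) = boundaryHamiltonian G L → φ H = 0}

/-- The restriction of a functional to the local algebra of `Λ`. -/
def restrictTo (Λ : Finset Bond) (ω : QLA G →ₗ[ℂ] ℂ) : localAlg G Λ →ₗ[ℂ] ℂ :=
  ω ∘ₗ (localAlg G Λ).toSubalgebra.val.toLinearMap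

end Model

end QuantumDouble

end

/-!
The projectors `D_v^χ` onto the electric charges and `B_f^c` onto the magnetic charges are two
commuting families of projectors, each a resolution of the identity at every position
(`IsChargeFamily`). In the joint eigenspace of a charge configuration in `Λ_L`, the operator
`H_L - D_L^ε - D_L^μ` is the sum, over the electric and the magnetic charges, of the number of
charged positions, diminished by one if the total charge is nontrivial (`excessOp`,
`hamiltonian_sub_boundary`). This number is nonnegative, which makes the operator positive, and if
it is nonzero there are charges at two different positions.

*Ground states have zero energy.* If there are charges at two positions, a unitary string operator
(`exists_elecString`, `exists_magString`) can move the first charge onto the second. The string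
operator times the projector onto the two charges is an eigenoperator of the dynamics which lowers
the energy by one or two, so the ground state inequality forces the ground state to vanish on the
pair of charges (`IsGroundState.map_elecCharge_mul`, `IsGroundState.map_magCharge_mul`). By the
Cauchy–Schwarz inequality it vanishes on every sector of nonzero excess.

*The boundary terms are ribbon operators.* The projector onto trivial total electric charge is the
average over `g` of the gauge transformations by `g` at all inner vertices. They cancel on the inner
bonds, and what remains is the shift of the bonds across the boundary ribbon
(`prod_crossElt_boundaryRibbon`). The total magnetic charge is the product of the monodromies of the
faces, which is the inverse of the holonomy along the boundary ribbon by the discrete Stokes theorem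
(`prod_holonomy_boundaryRibbon`). So both terms are supported on the bonds of the boundary ribbon,
which lie in `Λ_L \ Λ_{L-1}`.

*States of zero energy are ground states.* For `A` in the algebra of `Λ_L`, the generator is the
commutator with `H_{L+1}`, or equally with `K = H_{L+1} - D_{L+1}^ε - D_{L+1}^μ`, since the boundary
terms commute with `A`. If `K = b* b` and `ω(K) = 0`, then `ω(A* A K) = 0` by the Cauchy–Schwarz
inequality, so `ω(A* [K, A]) = ω((b A)* (b A)) ≥ 0`. States are continuous, and the inequality
passes to the closure of the generator.
-/

noncomputable section

namespace QuantumDouble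

/-! ### Observables as operators on configurations -/

section Pointwise

variable {G : Type*} [Fintype G] [DecidableEq G]

/-- The quasi-local algebra in its defining representation on `ℓ²(Bond → G)`. -/
def toOp : QLA G →⋆ₐ[ℂ] (HSpace G →L[ℂ] HSpace G) := (quasiLocal G).subtype

theorem toOp_injective : Function.Injective (toOp (G := G)) := Subtype.val_injective

/-- Elements of the quasi-local algebra are determined by their values on configurations. -/
theorem ext_toOp {x y : QLA G} (h : ∀ ψ σ, toOp x ψ σ = toOp y ψ σ) : x = y := by
  apply toOp_injective
  ext ψ σ
  exact h ψ σ

@[simp] theorem toOp_obs (Λ : Finset Bond) (M : Matrix (Λ → G) (Λ → G) ℂ) :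
    toOp (obs Λ M) = localRep Λ M := rfl

theorem toOp_mul_apply (x y : QLA G) (ψ : HSpace G) (σ : Bond → G) :
    toOp (x * y) ψ σ = toOp x (toOp y ψ) σ := by
  rw [map_mul]; rfl

theorem toOp_add_apply (x y : QLA G) (ψ : HSpace G) (σ : Bond → G) :
    toOp (x + y) ψ σ = toOp x ψ σ + toOp y ψ σ := by
  rw [map_add]; rfl

theorem toOp_smul_apply (c : ℂ) (x : QLA G) (ψ : HSpace G) (σ : Bond → G) :
    toOp (c • x) ψ σ = c * toOp x ψ σ := by
  rw [map_smul]; rfl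

theorem toOp_one_apply (ψ : HSpace G) (σ : Bond → G) : toOp (1 : QLA G) ψ σ = ψ σ := by
  rw [map_one]; rfl

theorem toOp_zero_apply (ψ : HSpace G) (σ : Bond → G) : toOp (0 : QLA G) ψ σ = 0 := by
  rw [map_zero]; rfl

theorem toOp_sum_apply {ι : Type*} (s : Finset ι) (x : ι → QLA G) (ψ : HSpace G) (σ : Bond → G) :
    toOp (∑ i ∈ s, x i) ψ σ = ∑ i ∈ s, toOp (x i) ψ σ := by
  classical
  induction s using Finset.induction_on with
  | empty => simp
  | insert a s ha ih => rw [Finset.sum_insert ha, Finset.sum_insert ha, toOp_add_apply, ih]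

/-- `x` is multiplication by the function `φ` of the configuration. -/
def IsDiag (x : QLA G) (φ : (Bond → G) → ℂ) : Prop :=
  ∀ ψ σ, toOp x ψ σ = φ σ * ψ σ

theorem IsDiag.eq {x y : QLA G} {φ : (Bond → G) → ℂ} (hx : IsDiag x φ) (hy : IsDiag y φ) :
    x = y := ext_toOp fun ψ σ => by rw [hx, hy]

theorem IsDiag.congr {x : QLA G} {φ χ : (Bond → G) → ℂ} (hx : IsDiag x φ) (h : ∀ σ, φ σ = χ σ) :
    IsDiag x χ := (funext h : φ = χ) ▸ hx

theorem IsDiag.mul {x y : QLA G} {φ χ : (Bond → G) → ℂ} (hx : IsDiag x φ) (hy : IsDiag y χ) :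
    IsDiag (x * y) fun σ => φ σ * χ σ := fun ψ σ => by
  rw [toOp_mul_apply, hx, hy, mul_assoc]

theorem IsDiag.one : IsDiag (1 : QLA G) fun _ => 1 := fun ψ σ => by rw [toOp_one_apply, one_mul]

theorem IsDiag.zero : IsDiag (0 : QLA G) fun _ => 0 := fun ψ σ => by rw [toOp_zero_apply, zero_mul]

theorem IsDiag.sum {ι : Type*} {s : Finset ι} {x : ι → QLA G} {φ : ι → (Bond → G) → ℂ}
    (h : ∀ i, IsDiag (x i) (φ i)) : IsDiag (∑ i ∈ s, x i) fun σ => ∑ i ∈ s, φ i σ := fun ψ σ => by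
  rw [toOp_sum_apply, Finset.sum_mul]
  exact Finset.sum_congr rfl fun i _ => h i ψ σ

theorem IsDiag.list_prod {ι : Type*} {l : List ι} {x : ι → QLA G} {φ : ι → (Bond → G) → ℂ}
    (h : ∀ i, IsDiag (x i) (φ i)) :
    IsDiag (l.map x).prod fun σ => (l.map fun i => φ i σ).prod := by
  induction l with
  | nil => exact IsDiag.one
  | cons i l ih => simpa using (h i).mul ih

theorem IsDiag.commute {x y : QLA G} {φ χ : (Bond → G) → ℂ} (hx : IsDiag x φ) (hy : IsDiag y χ) :
    Commute x y :=
  (hx.mul hy).eq ((hy.mul hx).congr fun _ => mul_comm _ _)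

/-- A diagonal matrix acts as a multiplication operator. -/
theorem isDiag_obs_diagonal {Λ : Finset Bond} {d : (Λ → G) → ℂ} {φ : (Bond → G) → ℂ}
    (h : ∀ σ, d (restr Λ σ) = φ σ) : IsDiag (obs Λ (Matrix.diagonal d)) φ := fun ψ σ => by
  rw [toOp_obs, localRep_apply, Finset.sum_eq_single (restr Λ σ)]
  · rw [Matrix.diagonal_apply_eq, h, override_restr]
  · intro b _ hb
    rw [Matrix.diagonal_apply_ne _ hb.symm, zero_mul]
  · simp

section Shift

variable [CommGroup G]

/-- `x` is the shift of the configurations by `s`. -/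
def IsShift (x : QLA G) (s : Bond → G) : Prop :=
  ∀ ψ σ, toOp x ψ σ = ψ (s⁻¹ * σ)

theorem IsShift.eq {x y : QLA G} {s : Bond → G} (hx : IsShift x s) (hy : IsShift y s) :
    x = y := ext_toOp fun ψ σ => by rw [hx, hy]

theorem IsShift.mul {x y : QLA G} {s t : Bond → G} (hx : IsShift x s) (hy : IsShift y t) :
    IsShift (x * y) (s * t) := fun ψ σ => by
  rw [toOp_mul_apply, hx, hy, ← mul_assoc, mul_inv_rev]

theorem IsShift.one : IsShift (1 : QLA G) 1 := fun ψ σ => by rw [toOp_one_apply, inv_one, one_mul]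

theorem IsShift.commute {x y : QLA G} {s t : Bond → G} (hx : IsShift x s) (hy : IsShift y t) :
    Commute x y :=
  (hx.mul hy).eq (mul_comm t s ▸ hy.mul hx)

theorem IsShift.list_prod {ι : Type*} {l : List ι} {x : ι → QLA G} {s : ι → Bond → G}
    (h : ∀ i, IsShift (x i) (s i)) : IsShift (l.map x).prod (l.map s).prod := by
  induction l with
  | nil => exact IsShift.one
  | cons i l ih => simpa using (h i).mul ih

/-- Moving a multiplication operator through a shift. -/
theorem IsShift.mul_isDiag {x y z : QLA G} {s : Bond → G} {φ χ : (Bond → G) → ℂ}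
    (hx : IsShift x s) (hy : IsDiag y φ) (hz : IsDiag z χ) (h : ∀ σ, φ σ = χ (s * σ)) :
    x * y = z * x := ext_toOp fun ψ σ => by
  rw [toOp_mul_apply, toOp_mul_apply, hx, hy, hz, hx, h, mul_inv_cancel_left]

/-- The matrix of a map `T` acts as a shift if `T` is a translation of the configurations in `Λ`. -/
theorem isShift_obs_moveMat {Λ : Finset Bond} {T : (Bond → G) → Bond → G} {s : Bond → G}
    (hT : ∀ c, T c = s * c) (hs : ∀ x ∉ Λ, s x = 1) : IsShift (obs Λ (moveMat Λ T)) s := by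
  intro ψ σ
  -- Only one entry of the row `restr Λ σ` of the matrix is nonzero.
  have e : ∀ b : Λ → G, restr Λ σ = restr Λ (T (extend Λ b)) ↔ b = restr Λ (s⁻¹ * σ) := by
    intro b
    have : restr Λ (T (extend Λ b)) = restr Λ s * b := by
      rw [hT]
      conv_rhs => rw [← restr_override Λ b 1]
      rfl
    have h2 : restr Λ (s⁻¹ * σ) = (restr Λ s)⁻¹ * restr Λ σ := rfl
    rw [this, h2, eq_inv_mul_iff_mul_eq, eq_comm]
  rw [toOp_obs, localRep_apply, Finset.sum_eq_single (restr Λ (s⁻¹ * σ))]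
  · rw [moveMat, Matrix.of_apply, if_pos ((e _).2 rfl), one_mul]
    have e2 : override Λ (restr Λ (s⁻¹ * σ)) σ = s⁻¹ * σ := by
      funext x
      by_cases hx : x ∈ Λ <;> simp [override, restr, hx, hs]
    rw [e2]
  · intro b _ hb
    rw [moveMat, Matrix.of_apply, if_neg (fun h => hb ((e b).1 h)), zero_mul]
  · simp

end Shift

/-! ### Locality -/

theorem obs_mem_localAlg (Λ : Finset Bond) (M : Matrix (Λ → G) (Λ → G) ℂ) :
    obs Λ M ∈ localAlg G Λ := ⟨M, rfl⟩

theorem localAlg_mono {Λ₁ Λ₂ : Finset Bond} (h : Λ₁ ⊆ Λ₂) : localAlg G Λ₁ ≤ localAlg G Λ₂ := by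
  rintro _ ⟨M, rfl⟩
  exact ⟨inclMat h M, obs_inclMat h M⟩

/-- Observables of disjoint volumes commute. -/
theorem commute_of_disjoint {Λ₁ Λ₂ : Finset Bond} (h : Disjoint Λ₁ Λ₂) {x y : QLA G}
    (hx : x ∈ localAlg G Λ₁) (hy : y ∈ localAlg G Λ₂) : Commute x y := by
  obtain ⟨M, rfl⟩ := hx
  obtain ⟨N, rfl⟩ := hy
  have key : ∀ (Λ₁ Λ₂ : Finset Bond), Disjoint Λ₁ Λ₂ → ∀ (b : Λ₁ → G) (σ : Bond → G),
      restr Λ₂ (override Λ₁ b σ) = restr Λ₂ σ := by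
    intro Λ₁ Λ₂ h b σ
    funext x
    have : x.1 ∉ Λ₁ := fun hx => Finset.disjoint_left.1 h hx x.2
    simp [restr, override, this]
  refine ext_toOp fun ψ σ => ?_
  change toOp (obs Λ₁ M * obs Λ₂ N) ψ σ = toOp (obs Λ₂ N * obs Λ₁ M) ψ σ
  simp only [toOp_mul_apply, toOp_obs, localRep_apply, Finset.mul_sum, key _ _ h, key _ _ h.symm]
  rw [Finset.sum_comm]
  refine Finset.sum_congr rfl fun b _ => Finset.sum_congr rfl fun a _ => ?_
  have : override Λ₂ b (override Λ₁ a σ) = override Λ₁ a (override Λ₂ b σ) := by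
    funext x
    by_cases h1 : x ∈ Λ₁
    · simp [override, h1, Finset.disjoint_left.1 h h1]
    · by_cases h2 : x ∈ Λ₂ <;> simp [override, h1, h2]
  rw [this]; ring

theorem mul_mem_localAlg_union {Λ₁ Λ₂ : Finset Bond} {x y : QLA G} (hx : x ∈ localAlg G Λ₁)
    (hy : y ∈ localAlg G Λ₂) : x * y ∈ localAlg G (Λ₁ ∪ Λ₂) :=
  mul_mem (localAlg_mono Finset.subset_union_left hx) (localAlg_mono Finset.subset_union_right hy)

end Pointwise

/-! ### Positive functionals -/

section Functional

variable {A : Type*} [Ring A] [StarRing A] [Algebra ℂ A] [StarModule ℂ A]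

/-- A real affine function with complex values in `[0, ∞)` is constant. -/
theorem eq_zero_of_forall_nonneg {α β : ℂ} (h : ∀ t : ℝ, 0 ≤ α + t * β) : β = 0 := by
  have h0 := h 0
  have h1 := h 1
  -- If `β.re ≠ 0`, the real part is `-1` at this value of `t`.
  have h2 := h (-(α.re + 1) / β.re)
  rw [Complex.nonneg_iff] at h0 h1 h2
  simp only [Complex.add_re, Complex.add_im, Complex.re_ofReal_mul, Complex.im_ofReal_mul,
    zero_mul, one_mul, add_zero] at h0 h1 h2
  have hre : β.re = 0 := by
    by_contra hne
    rw [div_mul_cancel₀ _ hne] at h2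
    linarith [h2.1]
  refine Complex.ext hre ?_
  rw [Complex.zero_im]
  linarith [h0.2, h1.2]

/-- The degenerate case of the Cauchy–Schwarz inequality: a positive functional that vanishes on
`b* b` vanishes on the left ideal generated by `b`. -/
theorem map_mul_eq_zero {ω : A →ₗ[ℂ] ℂ} (hω : ∀ a, IsPos a → 0 ≤ ω a) {b : A}
    (hb : ω (star b * b) = 0) (x : A) : ω (x * b) = 0 := by
  -- Positivity on `star x + z • b` is an affine condition on `z`, because `ω (star b * b) = 0`;
  -- real and imaginary `z` give two linear equations.
  have key : ∀ z : ℂ, 0 ≤ ω (x * star x) + (z * ω (x * b) + star z * ω (star b * star x)) := by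
    intro z
    have h := hω _ ⟨star x + z • b, rfl⟩
    have e : star (star x + z • b) * (star x + z • b)
        = x * star x + (z • (x * b) + star z • (star b * star x))
          + (star z * z) • (star b * b) := by
      simp only [star_add, star_star, star_smul, add_mul, mul_add, smul_mul_assoc, mul_smul_comm,
        smul_add, smul_smul]
      rw [mul_comm z]
      abel
    rwa [e, map_add, map_smul, hb, smul_zero, add_zero, map_add, map_add, map_smul, map_smul,
      smul_eq_mul, smul_eq_mul] at h
  have h1 : ω (x * b) + ω (star b * star x) = 0 := by
    refine eq_zero_of_forall_nonneg (α := ω (x * star x)) fun t => ?_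
    have := key t
    simpa [mul_add] using this
  have h2 : Complex.I * (ω (x * b) - ω (star b * star x)) = 0 := by
    refine eq_zero_of_forall_nonneg (α := ω (x * star x)) fun t => ?_
    have := key (t * Complex.I)
    convert this using 2
    simp
    ring
  have h3 := (mul_eq_zero.1 h2).resolve_left Complex.I_ne_zero
  linear_combination (h1 + h3) / 2

end Functional

/-! ### Commuting families of charge projectors -/

section Excess

variable {ι C : Type*} [Fintype ι] [DecidableEq C] [CommMonoid C]

/-- The number of charged positions of `κ`, diminished by one if the total charge is
nontrivial. -/
def excess (κ : ι → C) : ℝ :=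
  (Finset.univ.filter fun s => κ s ≠ 1).card - if ∏ s, κ s = 1 then 0 else 1

theorem exists_ne_one_of_prod_ne_one {κ : ι → C} (h : ∏ s, κ s ≠ 1) : ∃ s, κ s ≠ 1 := by
  by_contra! hall
  exact h (Finset.prod_eq_one fun s _ => hall s)

theorem excess_nonneg (κ : ι → C) : 0 ≤ excess κ := by
  unfold excess
  split_ifs with h
  · simp
  · obtain ⟨s, hs⟩ := exists_ne_one_of_prod_ne_one h
    have : 1 ≤ (Finset.univ.filter fun s => κ s ≠ 1).card :=
      Finset.card_pos.2 ⟨s, by simpa using hs⟩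
    rw [sub_nonneg]
    exact_mod_cast this

/-- If the excess does not vanish there are two charged positions: a single charge makes the total
charge nontrivial. -/
theorem exists_pair_of_excess_ne_zero {κ : ι → C} (h : excess κ ≠ 0) :
    ∃ s t, s ≠ t ∧ κ s ≠ 1 ∧ κ t ≠ 1 := by
  classical
  by_contra! hall
  apply h
  unfold excess
  by_cases hex : ∃ s, κ s ≠ 1
  · obtain ⟨s, hs⟩ := hex
    have hother : ∀ t, t ≠ s → κ t = 1 := fun t ht => hall s t ht.symm hs
    have h1 : (Finset.univ.filter fun s => κ s ≠ 1) = {s} := by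
      ext t
      simp only [Finset.mem_filter, Finset.mem_univ, true_and, Finset.mem_singleton]
      exact ⟨fun ht => by_contra fun hne => ht (hother t hne), fun ht => ht ▸ hs⟩
    have h2 : ∏ t, κ t = κ s := Fintype.prod_eq_single s hother
    rw [h1, h2, if_neg hs]
    simp
  · push Not at hex
    simp [hex]

end Excess

section ChargeFamily

variable {ι C A : Type*} [Fintype C]

/-- A product of sums of commuting elements, expanded. The factors generate a commutative ring, in
which this is the distributive law. -/
theorem sum_list_prod_of_commute {R : Type*} [Ring R] [Fintype ι] [DecidableEq ι] {P : ι → C → R}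
    (comm : ∀ s c t d, Commute (P s c) (P t d)) (h : ∀ s, ∑ c, P s c = 1) :
    ∑ κ : ι → C, ((Finset.univ : Finset ι).toList.map fun s => P s (κ s)).prod = 1 := by
  let S : Set R := Set.range fun p : ι × C => P p.1 p.2
  have hS : ∀ a ∈ S, ∀ b ∈ S, a * b = b * a := by
    rintro _ ⟨p, rfl⟩ _ ⟨q, rfl⟩
    exact comm _ _ _ _
  have := Algebra.isMulCommutative_adjoin ℤ hS
  open scoped IsMulCommutative in
  let _ : CommRing (Algebra.adjoin ℤ S) := inferInstance
  let p : ι → C → Algebra.adjoin ℤ S := fun s c =>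
    ⟨P s c, Algebra.subset_adjoin ⟨(s, c), rfl⟩⟩
  have hp : ∀ s, ∑ c, p s c = 1 := by
    intro s
    apply Subtype.val_injective
    rw [AddSubmonoidClass.coe_finsetSum]
    exact h s
  have key : ∑ κ : ι → C, ∏ s, p s (κ s) = 1 := by
    have := Finset.prod_univ_sum (fun _ : ι => (Finset.univ : Finset C)) (f := p)
    rw [Fintype.piFinset_univ] at this
    rw [← this]
    exact Finset.prod_eq_one fun s _ => hp s
  have := congrArg (Algebra.adjoin ℤ S).val key
  rw [map_sum, map_one] at this
  rw [← this]
  refine Finset.sum_congr rfl fun κ _ => ?_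
  rw [← Finset.prod_map_toList, map_list_prod, List.map_map]
  rfl

variable [DecidableEq C] [Ring A] [StarRing A]

/-- A family of projectors `P s c` (onto the charge `c` at the position `s`): they are
self-adjoint, commute, and for each position they are a resolution of the identity. -/
structure IsChargeFamily (P : ι → C → A) : Prop where
  star_eq : ∀ s c, star (P s c) = P s c
  mul_eq : ∀ s c d, P s c * P s d = if c = d then P s c else 0
  sum_eq : ∀ s, ∑ c, P s c = 1
  comm : ∀ s c t d, Commute (P s c) (P t d)

/-- The product of the projectors onto the charges `κ s` at the positions `s` in `l`. -/
def sector (P : ι → C → A) (l : List ι) (κ : ι → C) : A := (l.map fun s => P s (κ s)).prod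

theorem IsChargeFamily.comp {ι' : Type*} {P : ι → C → A} (hP : IsChargeFamily P) (f : ι' → ι) :
    IsChargeFamily fun s => P (f s) :=
  ⟨fun _ => hP.star_eq _, fun _ => hP.mul_eq _, fun _ => hP.sum_eq _,
    fun _ _ _ => hP.comm _ _ _⟩

namespace IsChargeFamily

variable {P : ι → C → A}

theorem commute_sector (hP : IsChargeFamily P) (s : ι) (c : C) (l : List ι) (κ : ι → C) :
    Commute (P s c) (sector P l κ) := by
  refine Commute.list_prod_right _ _ fun x hx => ?_
  obtain ⟨t, _, rfl⟩ := List.mem_map.1 hx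
  exact hP.comm _ _ _ _

theorem mul_sector (hP : IsChargeFamily P) {s : ι} {l : List ι} (hs : s ∈ l) (c : C) (κ : ι → C) :
    P s c * sector P l κ = if c = κ s then sector P l κ else 0 := by
  induction l with
  | nil => simp at hs
  | cons t l ih =>
    have e : sector P (t :: l) κ = P t (κ t) * sector P l κ := by simp [sector]
    rw [e]
    rcases List.mem_cons.1 hs with rfl | hs
    · rw [← mul_assoc, hP.mul_eq]
      split_ifs with h
      · rw [h]
      · rw [zero_mul]
    · rw [← mul_assoc, (hP.comm s c t _).eq, mul_assoc, ih hs]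
      split_ifs <;> simp

theorem star_sector (hP : IsChargeFamily P) (l : List ι) (κ : ι → C) :
    star (sector P l κ) = sector P l κ := by
  induction l with
  | nil => simp [sector]
  | cons t l ih =>
    have e : sector P (t :: l) κ = P t (κ t) * sector P l κ := by simp [sector]
    rw [e, star_mul, ih, hP.star_eq, (hP.commute_sector t _ l κ).eq]

theorem sector_mul_sector (hP : IsChargeFamily P) {l l' : List ι} (h : l' ⊆ l) (κ : ι → C) :
    sector P l' κ * sector P l κ = sector P l κ := by
  induction l' with
  | nil => simp [sector]
  | cons t l' ih =>
    rw [List.cons_subset] at h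
    have e : sector P (t :: l') κ = P t (κ t) * sector P l' κ := by simp [sector]
    rw [e, mul_assoc, ih h.2, hP.mul_sector h.1, if_pos rfl]

theorem star_mul_self (hP : IsChargeFamily P) (s t : ι) (c d : C) :
    star (P s c * P t d) * (P s c * P t d) = P s c * P t d := by
  rw [star_mul, hP.star_eq, hP.star_eq, (hP.comm t _ s _).eq, mul_assoc,
    ← mul_assoc (P t _), (hP.comm t _ s _).eq, mul_assoc, ← mul_assoc (P s _), hP.mul_eq,
    if_pos rfl, hP.mul_eq, if_pos rfl]

/-- A unitary does not change the length of `P s c * P t d`. -/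
theorem star_mul_self_unitary (hP : IsChargeFamily P) {U : A} (hU : star U * U = 1)
    (s t : ι) (c d : C) :
    star (U * (P s c * P t d)) * (U * (P s c * P t d)) = P s c * P t d := by
  rw [star_mul, mul_assoc, ← mul_assoc (star U), hU, one_mul, hP.star_mul_self]

variable [Fintype ι]

/-- The projector onto the charge configuration `κ`. -/
def _root_.QuantumDouble.fullSector (P : ι → C → A) (κ : ι → C) : A :=
  sector P (Finset.univ : Finset ι).toList κ

theorem mul_fullSector (hP : IsChargeFamily P) (s : ι) (c : C) (κ : ι → C) :
    P s c * fullSector P κ = if c = κ s then fullSector P κ else 0 :=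
  hP.mul_sector (by simp) c κ

theorem star_fullSector (hP : IsChargeFamily P) (κ : ι → C) :
    star (fullSector P κ) = fullSector P κ := hP.star_sector _ κ

theorem commute_fullSector (hP : IsChargeFamily P) (s : ι) (c : C) (κ : ι → C) :
    Commute (P s c) (fullSector P κ) := hP.commute_sector s c _ κ

theorem fullSector_mul (hP : IsChargeFamily P) (κ κ' : ι → C) :
    fullSector P κ * fullSector P κ' = if κ = κ' then fullSector P κ else 0 := by
  split_ifs with h
  · subst h
    exact hP.sector_mul_sector (fun _ h => h) κ
  · obtain ⟨s, hs⟩ := Function.ne_iff.1 h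
    have h1 := hP.mul_fullSector s (κ s) κ
    rw [if_pos rfl] at h1
    have h2 := hP.mul_fullSector s (κ s) κ'
    rw [if_neg hs] at h2
    rw [← h1, (hP.commute_fullSector s _ κ).eq, mul_assoc, h2, mul_zero]

variable [DecidableEq ι]

theorem sum_fullSector (hP : IsChargeFamily P) : ∑ κ, fullSector P κ = 1 :=
  sum_list_prod_of_commute hP.comm hP.sum_eq

/-- Multiplication by `x` is determined by its values on the sectors. -/
theorem ext_sector (hP : IsChargeFamily P) {x y : A}
    (h : ∀ κ, x * fullSector P κ = y * fullSector P κ) : x = y := by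
  rw [← mul_one x, ← mul_one y, ← hP.sum_fullSector, Finset.mul_sum, Finset.mul_sum]
  exact Finset.sum_congr rfl fun κ _ => h κ

end IsChargeFamily

variable [Fintype ι] [DecidableEq ι] [CommMonoid C]

theorem IsChargeFamily.sum_neutral_mul {P : ι → C → A} (hP : IsChargeFamily P) (κ : ι → C) :
    (∑ κ' with ∏ s, κ' s = 1, fullSector P κ') * fullSector P κ
      = if ∏ s, κ s = 1 then fullSector P κ else 0 := by
  simp only [Finset.sum_mul, hP.fullSector_mul]
  by_cases h : ∏ s, κ s = 1 <;> simp [h]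

variable [Algebra ℂ A]

/-- The number of charges minus the projector onto nontrivial total charge. -/
def excessOp (P : ι → C → A) : A :=
  ∑ s, (1 - P s 1) - (1 - ∑ κ with ∏ s, κ s = 1, fullSector P κ)

namespace IsChargeFamily

variable {P : ι → C → A}

/-- The excess operator is the function `excess` of the charge configuration. -/
theorem excessOp_eq (hP : IsChargeFamily P) :
    excessOp P = ∑ κ, (excess κ : ℂ) • fullSector P κ := by
  refine hP.ext_sector fun κ => ?_
  have hr : (∑ κ, (excess κ : ℂ) • fullSector P κ) * fullSector P κ
      = (excess κ : ℂ) • fullSector P κ := by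
    simp only [Finset.sum_mul, smul_mul_assoc, hP.fullSector_mul]
    simp
  have hl : (∑ s, (1 - P s 1)) * fullSector P κ
      = ((Finset.univ.filter fun s => κ s ≠ 1).card : ℂ) • fullSector P κ := by
    rw [Finset.sum_mul, Finset.card_filter, Nat.cast_sum, Finset.sum_smul]
    refine Finset.sum_congr rfl fun s _ => ?_
    rw [sub_mul, one_mul, hP.mul_fullSector]
    by_cases h : κ s = 1
    · simp [h]
    · simp [h, Ne.symm h]
  have hm : (1 - ∑ κ with ∏ s, κ s = 1, fullSector P κ) * fullSector P κ
      = (if ∏ s, κ s = 1 then 0 else 1 : ℂ) • fullSector P κ := by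
    rw [sub_mul, one_mul, hP.sum_neutral_mul]
    split_ifs <;> simp
  rw [hr, excessOp, sub_mul, hl, hm, ← sub_smul, excess]
  congr 1
  split_ifs <;> simp

variable [StarModule ℂ A]

/-- The excess operator is positive, with an explicit square root. -/
theorem excessOp_eq_star_mul_self (hP : IsChargeFamily P) :
    excessOp P = star (∑ κ, (√(excess κ) : ℂ) • fullSector P κ) *
      ∑ κ, (√(excess κ) : ℂ) • fullSector P κ := by
  have e : star (∑ κ, (√(excess κ) : ℂ) • fullSector P κ)
      = ∑ κ, (√(excess κ) : ℂ) • fullSector P κ := by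
    simp [star_sum, star_smul, hP.star_fullSector]
  rw [e, hP.excessOp_eq, Finset.sum_mul]
  refine Finset.sum_congr rfl fun κ _ => ?_
  simp only [Finset.mul_sum, smul_mul_assoc, mul_smul_comm, hP.fullSector_mul]
  simp only [smul_ite, smul_zero, Finset.sum_ite_eq, Finset.mem_univ, if_true, smul_smul]
  rw [← Complex.ofReal_mul, Real.mul_self_sqrt (excess_nonneg κ)]

/-- A positive functional that vanishes on pairs of nontrivial charges vanishes on the excess
operator: every sector of nonzero excess contains such a pair. -/
theorem map_excessOp_eq_zero (hP : IsChargeFamily P) {ω : A →ₗ[ℂ] ℂ}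
    (hω : ∀ a, IsPos a → 0 ≤ ω a)
    (h : ∀ s t c d, s ≠ t → c ≠ 1 → d ≠ 1 → ω (P s c * P t d) = 0) :
    ω (excessOp P) = 0 := by
  rw [hP.excessOp_eq, map_sum]
  refine Finset.sum_eq_zero fun κ _ => ?_
  rw [map_smul]
  by_cases h0 : excess κ = 0
  · simp [h0]
  obtain ⟨s, t, hst, hs, ht⟩ := exists_pair_of_excess_ne_zero h0
  have e1 : fullSector P κ = fullSector P κ * (P s (κ s) * P t (κ t)) := by
    rw [← ((hP.commute_fullSector s _ κ).mul_left (hP.commute_fullSector t _ κ)).eq, mul_assoc,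
      hP.mul_fullSector, if_pos rfl, hP.mul_fullSector, if_pos rfl]
  rw [e1, map_mul_eq_zero hω (by rw [hP.star_mul_self]; exact h s t _ _ hst hs ht), smul_zero]

end IsChargeFamily

end ChargeFamily

/-! ### Characters of the gauge group -/

section Characters

variable {G : Type*} [CommGroup G] [Fintype G]

open Classical in
theorem sum_character (χ : Dual G) :
    ∑ g, (χ g : ℂ) = if χ = 1 then (Fintype.card G : ℂ) else 0 := by
  have h := sum_hom_units ((Units.coeHom ℂ).comp χ)
  have e : (Units.coeHom ℂ).comp χ = 1 ↔ χ = 1 := by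
    constructor
    · intro h
      ext g
      exact DFunLike.congr_fun h g
    · rintro rfl
      rfl
  simpa [e] using h

theorem card_cast_ne_zero : (Fintype.card G : ℂ) ≠ 0 := Nat.cast_ne_zero.2 Fintype.card_ne_zero

theorem card_dual : Fintype.card (Dual G) = Fintype.card G := by
  rw [← Nat.card_eq_fintype_card, ← Nat.card_eq_fintype_card]
  exact CommGroup.card_monoidHom_of_hasEnoughRootsOfUnity G ℂ

theorem sum_dual_apply [DecidableEq G] (g : G) :
    ∑ χ : Dual G, (χ g : ℂ) = if g = 1 then (Fintype.card G : ℂ) else 0 := by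
  classical
  have h := sum_hom_units ((Units.coeHom ℂ).comp (MonoidHom.eval g : Dual G →* ℂˣ))
  have e : (Units.coeHom ℂ).comp (MonoidHom.eval g : Dual G →* ℂˣ) = 1 ↔ g = 1 := by
    constructor
    · intro h
      by_contra hg
      obtain ⟨χ, hχ⟩ := CommGroup.exists_apply_ne_one_of_hasEnoughRootsOfUnity G ℂ hg
      exact hχ (Units.ext (DFunLike.congr_fun h χ))
    · rintro rfl
      ext χ
      simp
  simpa [e, card_dual] using h

theorem conj_character (χ : Dual G) (g : G) : (starRingEnd ℂ) (χ g : ℂ) = (χ g⁻¹ : ℂ) := by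
  have h1 : (χ g : ℂ) ^ Fintype.card G = 1 := by
    rw [← Units.val_pow_eq_pow_val, ← map_pow, pow_card_eq_one, map_one, Units.val_one]
  have h2 := Complex.norm_eq_one_of_pow_eq_one h1 Fintype.card_ne_zero
  rw [map_inv, Units.val_inv_eq_inv_val, Complex.inv_eq_conj h2]

theorem sum_conj_mul (χ χ' : Dual G) [Decidable (χ = χ')] :
    ∑ g, (starRingEnd ℂ) (χ g : ℂ) * (χ' g : ℂ) = if χ = χ' then (Fintype.card G : ℂ) else 0 := by
  classical
  have h := sum_character (χ⁻¹ * χ')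
  have e : χ⁻¹ * χ' = 1 ↔ χ = χ' :=
    ⟨fun h => MonoidHom.ext fun g => inv_mul_eq_one.1 (DFunLike.congr_fun h g), fun h =>
      MonoidHom.ext fun g => inv_mul_eq_one.2 (DFunLike.congr_fun h g)⟩
  simp only [e] at h
  refine Eq.trans ?_ (h.trans (by congr))
  refine Finset.sum_congr rfl fun g _ => ?_
  rw [conj_character, MonoidHom.mul_apply, MonoidHom.inv_apply, map_inv, Units.val_mul]

end Characters

/-! ### Star and plaquette operators -/

section Charges

variable {G : Type*} [CommGroup G]

/-- The configuration by which the gauge transformation by `g` at `v` shifts. -/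
def gaugeElt (v : ℤ × ℤ) (g : G) : Bond → G := fun x =>
  if x.src = v then g else if x.tgt = v then g⁻¹ else 1

theorem gauge_eq (v : ℤ × ℤ) (g : G) (c : Bond → G) : gauge v g c = gaugeElt v g * c := by
  funext x
  simp only [gauge, gaugeElt, Pi.mul_apply]
  split_ifs <;> simp [mul_comm]

theorem gaugeElt_mul (v : ℤ × ℤ) (g h : G) :
    gaugeElt v (g * h) = gaugeElt v g * gaugeElt v h := by
  funext x
  simp only [gaugeElt, Pi.mul_apply]
  split_ifs <;> simp [mul_comm]

theorem gaugeElt_one (v : ℤ × ℤ) : gaugeElt v (1 : G) = 1 := by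
  funext x
  simp [gaugeElt]

theorem gaugeElt_inv (v : ℤ × ℤ) (g : G) : gaugeElt v g⁻¹ = (gaugeElt v g)⁻¹ := by
  rw [eq_inv_iff_mul_eq_one, ← gaugeElt_mul, inv_mul_cancel, gaugeElt_one]

theorem mem_starBonds {v : ℤ × ℤ} {x : Bond} : x ∈ starBonds v ↔ x.src = v ∨ x.tgt = v := by
  obtain ⟨⟨a, b⟩, d⟩ := x
  obtain ⟨i, j⟩ := v
  cases d <;> simp [starBonds, Bond.tgt] <;> omega

theorem gaugeElt_of_notMem {v : ℤ × ℤ} {x : Bond} (hx : x ∉ starBonds v) (g : G) :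
    gaugeElt v g x = 1 := by
  rw [mem_starBonds, not_or] at hx
  rw [gaugeElt, if_neg hx.1, if_neg hx.2]

theorem monodromy_mul (f : ℤ × ℤ) (s c : Bond → G) :
    monodromy f (s * c) = monodromy f s * monodromy f c := by
  simp only [monodromy, Pi.mul_apply, mul_inv]
  simp only [mul_assoc, mul_left_comm, mul_comm]

theorem monodromy_one (f : ℤ × ℤ) : monodromy f (1 : Bond → G) = 1 := by simp [monodromy]

/-- The monodromy is gauge invariant. -/
theorem monodromy_gaugeElt (f v : ℤ × ℤ) (g : G) : monodromy f (gaugeElt v g) = 1 := by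
  obtain ⟨a, b⟩ := f
  obtain ⟨i, j⟩ := v
  simp only [monodromy, gaugeElt, leftSide, rightSide, topSide, bottomSide, Bond.tgt, Prod.mk.injEq]
  split_ifs <;> first | omega | simp

theorem monodromy_congr {f : ℤ × ℤ} {c d : Bond → G} (h : ∀ x ∈ plaquette f, c x = d x) :
    monodromy f c = monodromy f d := by
  simp only [monodromy]
  rw [h (leftSide f) (by simp [plaquette]), h (rightSide f) (by simp [plaquette]),
    h (topSide f) (by simp [plaquette]), h (bottomSide f) (by simp [plaquette])]

theorem extend_restr_apply {Λ : Finset Bond} {x : Bond} (hx : x ∈ Λ) (σ : Bond → G) :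
    extend Λ (restr Λ σ) x = σ x := by
  simp [extend, override, hx, restr]

variable [DecidableEq G]

theorem star_projMat (Λ : Finset Bond) (p : (Bond → G) → Prop) [DecidablePred p] :
    star (projMat Λ p) = projMat Λ p := by
  rw [projMat, Matrix.star_eq_conjTranspose, Matrix.diagonal_conjTranspose]
  congr 1
  funext a
  simp only [Pi.star_apply]
  split_ifs <;> simp

variable [Fintype G]

/-- The adjoint of a local shift is the inverse shift. -/
theorem isShift_star_obs_moveMat {Λ : Finset Bond} {T : (Bond → G) → Bond → G} {s : Bond → G}
    (hT : ∀ c, T c = s * c) (hs : ∀ x ∉ Λ, s x = 1) :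
    IsShift (star (obs Λ (moveMat Λ T))) s⁻¹ := by
  have e : star (moveMat Λ T) = moveMat Λ (s⁻¹ * ·) := by
    have h : ∀ (s : Bond → G) (b : Λ → G), restr Λ (s * extend Λ b) = restr Λ s * b := by
      intro s b
      conv_rhs => rw [← restr_override Λ b 1]
      rfl
    have hinv : restr Λ s⁻¹ = (restr Λ s)⁻¹ := rfl
    ext a b
    rw [Matrix.star_apply, moveMat, moveMat, Matrix.of_apply, Matrix.of_apply, hT, h, h, hinv]
    simp only [eq_inv_mul_iff_mul_eq, eq_comm (a := restr Λ s * a)]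
    split_ifs <;> simp
  rw [← map_star, e]
  exact isShift_obs_moveMat (fun _ => rfl) fun x hx => by simp [hs x hx]

theorem isShift_starOp (v : ℤ × ℤ) (g : G) : IsShift (starOp v g) (gaugeElt v g) :=
  isShift_obs_moveMat (gauge_eq v g) fun _ hx => gaugeElt_of_notMem hx g

theorem star_starOp (v : ℤ × ℤ) (g : G) : star (starOp v g) = starOp v g⁻¹ :=
  (isShift_star_obs_moveMat (gauge_eq v g) fun _ hx => gaugeElt_of_notMem hx g).eq
    (gaugeElt_inv v g ▸ isShift_starOp v g⁻¹)

theorem starOp_mul (v : ℤ × ℤ) (g h : G) : starOp v g * starOp v h = starOp v (g * h) :=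
  ((isShift_starOp v g).mul (isShift_starOp v h)).eq (gaugeElt_mul v g h ▸ isShift_starOp v _)

theorem starOp_one (v : ℤ × ℤ) : starOp v (1 : G) = 1 :=
  (gaugeElt_one (G := G) v ▸ isShift_starOp v 1).eq IsShift.one

theorem starOp_mem (v : ℤ × ℤ) (g : G) : starOp v g ∈ localAlg G (starBonds v) :=
  obs_mem_localAlg _ _

theorem elecCharge_mem (v : ℤ × ℤ) (χ : Dual G) : elecCharge v χ ∈ localAlg G (starBonds v) := by
  unfold elecCharge
  exact SMulMemClass.smul_mem _ (sum_mem fun g _ => SMulMemClass.smul_mem _ (starOp_mem v g))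

theorem isDiag_obs_projMat {Λ : Finset Bond} {p : (Bond → G) → Prop} [DecidablePred p]
    (hp : ∀ σ, p (extend Λ (restr Λ σ)) ↔ p σ) :
    IsDiag (obs Λ (projMat Λ p)) fun σ => if p σ then 1 else 0 :=
  isDiag_obs_diagonal fun σ => by simp only [hp]

theorem isDiag_plaqOp (f : ℤ × ℤ) (h : G) :
    IsDiag (plaqOp f h) fun σ => if monodromy f σ = h then 1 else 0 :=
  isDiag_obs_projMat fun σ => by
    rw [monodromy_congr fun x hx => extend_restr_apply hx σ]

theorem plaqOp_mem (f : ℤ × ℤ) (h : G) : plaqOp f h ∈ localAlg G (plaquette f) :=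
  obs_mem_localAlg _ _

theorem commute_starOp_plaqOp (v f : ℤ × ℤ) (g h : G) : Commute (starOp v g) (plaqOp f h) :=
  (isShift_starOp v g).mul_isDiag (isDiag_plaqOp f h) (isDiag_plaqOp f h) fun σ => by
    rw [monodromy_mul, monodromy_gaugeElt, one_mul]

/-- The charge `χ` at `v` transforms under the gauge transformations at `v` by the character `χ`. -/
theorem starOp_mul_elecCharge (v : ℤ × ℤ) (g : G) (χ : Dual G) :
    starOp v g * elecCharge v χ = (χ g : ℂ) • elecCharge v χ := by
  rw [elecCharge, mul_smul_comm, Finset.mul_sum, smul_comm (χ g : ℂ)]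
  congr 1
  rw [Finset.smul_sum]
  simp only [mul_smul_comm, starOp_mul]
  refine Eq.trans ?_ (Equiv.sum_comp (Equiv.mulLeft g)
    fun h => (χ g : ℂ) • (starRingEnd ℂ) (χ h : ℂ) • starOp v h)
  refine Finset.sum_congr rfl fun h _ => ?_
  rw [smul_smul, conj_character, conj_character, Equiv.coe_mulLeft, ← Units.val_mul, ← map_mul]
  congr 4
  rw [mul_inv, mul_inv_cancel_left]

variable (G) in
/-- The electric charge projectors form a charge family, by the orthogonality of characters. -/
theorem isChargeFamily_elecCharge [DecidableEq (Dual G)] :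
    IsChargeFamily (elecCharge (G := G)) where
  star_eq v χ := by
    simp only [elecCharge, star_smul, star_sum, star_starOp]
    rw [← Equiv.sum_comp (Equiv.inv G) fun g => (starRingEnd ℂ) (χ g : ℂ) • starOp v g]
    congr 1
    · simp
    · refine Finset.sum_congr rfl fun g _ => ?_
      simp [conj_character]
  mul_eq v χ χ' := by
    conv_lhs => rw [elecCharge]
    simp only [smul_mul_assoc, Finset.sum_mul, starOp_mul_elecCharge, smul_smul]
    rw [← Finset.sum_smul, sum_conj_mul, smul_smul]
    split_ifs with h
    · rw [h, inv_mul_cancel₀ card_cast_ne_zero, one_smul]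
    · simp
  sum_eq v := by
    simp only [elecCharge]
    rw [← Finset.smul_sum, Finset.sum_comm]
    simp only [← Finset.sum_smul, conj_character, sum_dual_apply, inv_eq_one]
    simp [starOp_one, smul_smul]
  comm v χ w χ' := by
    refine (Commute.sum_left _ _ _ fun g _ => ?_).smul_left _
    refine Commute.smul_left ?_ _
    refine (Commute.sum_right _ _ _ fun h _ => ?_).smul_right _
    exact ((isShift_starOp v g).commute (isShift_starOp w h)).smul_right _

variable (G) in
theorem isChargeFamily_magCharge : IsChargeFamily (magCharge (G := G)) where
  star_eq f c := by rw [magCharge, plaqOp, ← map_star, star_projMat]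
  mul_eq f c d := by
    refine ((isDiag_plaqOp f c).mul (isDiag_plaqOp f d)).eq ?_
    split_ifs with h
    · subst h
      exact (isDiag_plaqOp f c).congr fun σ => by split_ifs <;> simp
    · exact IsDiag.zero.congr fun σ => by split_ifs <;> simp_all
  sum_eq f := (IsDiag.sum fun c => isDiag_plaqOp f c).eq (IsDiag.one.congr fun σ => by simp)
  comm f c f' c' := (isDiag_plaqOp f c).commute (isDiag_plaqOp f' c')

theorem commute_elecCharge_magCharge (v f : ℤ × ℤ) (χ : Dual G) (c : G) :
    Commute (elecCharge v χ) (magCharge f c) :=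
  (Commute.sum_left _ _ _ fun g _ => (commute_starOp_plaqOp v f g c).smul_left _).smul_left _

theorem starTerm_eq (v : ℤ × ℤ) : starTerm G v = elecCharge v 1 := by
  simp [starTerm, elecCharge]

theorem plaqTerm_eq (f : ℤ × ℤ) : plaqTerm G f = magCharge f 1 := rfl

end Charges

/-! ### Vertices and faces of the boxes -/

section Boxes

theorem mem_box {L : ℕ} {x : Bond} :
    x ∈ box L ↔ (-(L : ℤ) ≤ x.src.1 ∧ x.src.1 ≤ L ∧ -(L : ℤ) ≤ x.src.2 ∧ x.src.2 ≤ L) ∧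
      (-(L : ℤ) ≤ x.tgt.1 ∧ x.tgt.1 ≤ L ∧ -(L : ℤ) ≤ x.tgt.2 ∧ x.tgt.2 ≤ L) := by
  obtain ⟨⟨a, b⟩, d⟩ := x
  simp only [box, Finset.mem_filter, Finset.mem_image, Finset.mem_product, Finset.mem_Icc]
  constructor
  · rintro ⟨⟨⟨⟨p, q⟩, e⟩, hp, h⟩, h2⟩
    cases h
    tauto
  · rintro ⟨h1, h2⟩
    exact ⟨⟨⟨(a, b), d⟩, ⟨by tauto, by cases d <;> simp⟩, rfl⟩, by tauto⟩

theorem mem_starsIn_box {L : ℕ} {v : ℤ × ℤ} :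
    v ∈ starsIn (box L) ↔ -(L : ℤ) < v.1 ∧ v.1 < L ∧ -(L : ℤ) < v.2 ∧ v.2 < L := by
  obtain ⟨a, b⟩ := v
  have h : starBonds (a, b) ⊆ box L ↔ -(L : ℤ) < a ∧ a < L ∧ -(L : ℤ) < b ∧ b < L := by
    simp only [starBonds, Finset.insert_subset_iff, Finset.singleton_subset_iff, mem_box, Bond.tgt]
    omega
  rw [starsIn, Finset.mem_filter, h]
  refine and_iff_right_of_imp fun h' => Finset.mem_image.2 ⟨⟨(a, b), .up⟩, ?_, rfl⟩
  exact h.2 h' (by simp [starBonds])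

theorem mem_facesIn_box {L : ℕ} {f : ℤ × ℤ} :
    f ∈ facesIn (box L) ↔ -(L : ℤ) ≤ f.1 ∧ f.1 < L ∧ -(L : ℤ) ≤ f.2 ∧ f.2 < L := by
  obtain ⟨a, b⟩ := f
  have h : plaquette (a, b) ⊆ box L ↔ -(L : ℤ) ≤ a ∧ a < L ∧ -(L : ℤ) ≤ b ∧ b < L := by
    simp only [plaquette, leftSide, rightSide, topSide, bottomSide, Finset.insert_subset_iff,
      Finset.singleton_subset_iff, mem_box, Bond.tgt]
    omega
  rw [facesIn, Finset.mem_filter, h]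
  refine and_iff_right_of_imp fun h' => Finset.mem_image.2 ⟨⟨(a, b), .up⟩, ?_, rfl⟩
  exact h.2 h' (by simp [plaquette, leftSide])

theorem eventually_mem_starsIn (v : ℤ × ℤ) : ∀ᶠ L in atTop, v ∈ starsIn (box L) := by
  filter_upwards [eventually_gt_atTop (v.1.natAbs + v.2.natAbs)] with L hL
  rw [mem_starsIn_box]
  omega

theorem eventually_mem_facesIn (f : ℤ × ℤ) : ∀ᶠ L in atTop, f ∈ facesIn (box L) := by
  filter_upwards [eventually_gt_atTop (f.1.natAbs + f.2.natAbs)] with L hL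
  rw [mem_facesIn_box]
  omega

theorem eventually_subset_box (Λ : Finset Bond) : ∀ᶠ L in atTop, Λ ⊆ box L := by
  induction Λ using Finset.induction_on with
  | empty => simp
  | insert x Λ _ ih =>
    filter_upwards [ih, eventually_gt_atTop (x.src.1.natAbs + x.src.2.natAbs)] with L hL hx
    refine Finset.insert_subset ?_ hL
    obtain ⟨⟨a, b⟩, d⟩ := x
    rw [mem_box]
    cases d <;> simp only [Bond.tgt] at hx ⊢ <;> omega

/-- The star of a vertex outside `Λ_{L+1}` does not meet `Λ_L`. -/
theorem disjoint_starBonds_box {L : ℕ} {v : ℤ × ℤ} (hv : v ∉ starsIn (box (L + 1))) :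
    Disjoint (starBonds v) (box L) := by
  rw [Finset.disjoint_left]
  intro x hx hb
  rw [mem_starsIn_box] at hv
  rw [mem_starBonds] at hx
  rw [mem_box] at hb
  push_cast at hv
  rcases hx with rfl | rfl <;> omega

/-- The plaquette of a face outside `Λ_{L+1}` does not meet `Λ_L`. -/
theorem disjoint_plaquette_box {L : ℕ} {f : ℤ × ℤ} (hf : f ∉ facesIn (box (L + 1))) :
    Disjoint (plaquette f) (box L) := by
  rw [Finset.disjoint_left]
  intro x hx hb
  rw [mem_facesIn_box] at hf
  rw [mem_box] at hb
  push_cast at hf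
  simp only [plaquette, leftSide, rightSide, topSide, bottomSide, Finset.mem_insert,
    Finset.mem_singleton] at hx
  rcases hx with rfl | rfl | rfl | rfl <;> simp only [Bond.tgt] at hb <;> omega

theorem starBonds_subset {L : ℕ} {v : ℤ × ℤ} (hv : v ∈ starsIn (box L)) : starBonds v ⊆ box L :=
  (Finset.mem_filter.1 hv).2

theorem plaquette_subset {L : ℕ} {f : ℤ × ℤ} (hf : f ∈ facesIn (box L)) : plaquette f ⊆ box L :=
  (Finset.mem_filter.1 hf).2

/-- The square lattice is connected: an equivalence relation between neighbours relates all
vertices. -/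
theorem rel_of_neighbours {R : ℤ × ℤ → ℤ × ℤ → Prop} (hR : Equivalence R)
    (h1 : ∀ i j, R (i, j) (i + 1, j)) (h2 : ∀ i j, R (i, j) (i, j + 1)) (v w : ℤ × ℤ) : R v w := by
  have hx : ∀ i : ℤ, R (0, 0) (i, 0) := by
    intro i
    induction i using Int.induction_on with
    | zero => exact hR.refl _
    | succ i ih => exact hR.trans ih (h1 _ _)
    | pred i ih => exact hR.trans ih (hR.symm (by simpa using h1 (-(i : ℤ) - 1) 0))
  have hxy : ∀ i j : ℤ, R (0, 0) (i, j) := by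
    intro i j
    induction j using Int.induction_on with
    | zero => exact hx i
    | succ j ih => exact hR.trans ih (h2 _ _)
    | pred j ih => exact hR.trans ih (hR.symm (by simpa using h2 i (-(j : ℤ) - 1)))
  exact hR.trans (hR.symm (hxy v.1 v.2)) (hxy w.1 w.2)

end Boxes

/-! ### String operators -/

section Strings

variable {G : Type*} [CommGroup G]

/-- The holonomy along a path from `v` to `w`: a homomorphism from the group of configurations
to `G` that depends on finitely many bonds and detects the gauge transformations at the end points
only. -/
theorem exists_holonomy (v w : ℤ × ℤ) : ∃ (Λ : Finset Bond) (θ : (Bond → G) →* G),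
    (∀ σ τ, (∀ x ∈ Λ, σ x = τ x) → θ σ = θ τ) ∧
    ∀ u g, θ (gaugeElt u g) = (if u = v then g else 1) * (if u = w then g⁻¹ else 1) := by
  have hbond : ∀ x : Bond, x.src ≠ x.tgt → ∃ (Λ : Finset Bond) (θ : (Bond → G) →* G),
      (∀ σ τ, (∀ x ∈ Λ, σ x = τ x) → θ σ = θ τ) ∧
      ∀ u g, θ (gaugeElt u g) = (if u = x.src then g else 1) * (if u = x.tgt then g⁻¹ else 1) := by
    intro x hx
    refine ⟨{x}, Pi.evalMonoidHom _ x, fun σ τ h => h x (by simp), fun u g => ?_⟩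
    simp only [Pi.evalMonoidHom_apply, gaugeElt, eq_comm (a := u)]
    by_cases h1 : x.src = u
    · have h2 : x.tgt ≠ u := fun h => hx (h1.trans h.symm)
      simp [h1, h2]
    · simp [h1]
  refine rel_of_neighbours (R := fun v w => ∃ (Λ : Finset Bond) (θ : (Bond → G) →* G),
    (∀ σ τ, (∀ x ∈ Λ, σ x = τ x) → θ σ = θ τ) ∧
    ∀ u g, θ (gaugeElt u g) = (if u = v then g else 1) * (if u = w then g⁻¹ else 1))
    ⟨fun v => ?_, ?_, ?_⟩ ?_ ?_ v w
  · refine ⟨∅, 1, fun _ _ _ => rfl, fun u g => ?_⟩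
    split_ifs <;> simp
  · rintro v w ⟨Λ, θ, hΛ, hθ⟩
    refine ⟨Λ, θ⁻¹, fun σ τ h => ?_, fun u g => ?_⟩
    · rw [MonoidHom.inv_apply, MonoidHom.inv_apply, hΛ σ τ h]
    · rw [MonoidHom.inv_apply, hθ]
      split_ifs <;> simp
  · rintro u v w ⟨Λ, θ, hΛ, hθ⟩ ⟨Λ', θ', hΛ', hθ'⟩
    refine ⟨Λ ∪ Λ', θ * θ', fun σ τ h => ?_, fun u g => ?_⟩
    · rw [MonoidHom.mul_apply, MonoidHom.mul_apply,
        hΛ σ τ fun x hx => h x (Finset.mem_union_left _ hx),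
        hΛ' σ τ fun x hx => h x (Finset.mem_union_right _ hx)]
    · rw [MonoidHom.mul_apply, hθ, hθ']
      split_ifs <;> simp
  · intro i j
    exact hbond ⟨(i, j), .right⟩ (by simp [Bond.tgt])
  · intro i j
    exact hbond ⟨(i, j), .up⟩ (by simp [Bond.tgt])

/-- A path of faces from `p` to `q`: a configuration with finite support whose monodromy is
nontrivial at the end points only. -/
theorem exists_fluxString (c : G) (p q : ℤ × ℤ) : ∃ (Λ : Finset Bond) (s : Bond → G),
    (∀ x ∉ Λ, s x = 1) ∧
    ∀ f, monodromy f s = (if f = p then c else 1) * (if f = q then c⁻¹ else 1) := by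
  refine rel_of_neighbours (R := fun p q => ∃ (Λ : Finset Bond) (s : Bond → G),
    (∀ x ∉ Λ, s x = 1) ∧
    ∀ f, monodromy f s = (if f = p then c else 1) * (if f = q then c⁻¹ else 1))
    ⟨fun v => ?_, ?_, ?_⟩ ?_ ?_ p q
  · refine ⟨∅, 1, fun _ _ => rfl, fun f => ?_⟩
    rw [monodromy_one]
    split_ifs <;> simp
  · rintro p q ⟨Λ, s, hs, h⟩
    refine ⟨Λ, s⁻¹, fun x hx => by simp [hs x hx], fun f => ?_⟩
    have : monodromy f s⁻¹ = (monodromy f s)⁻¹ := by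
      rw [eq_inv_iff_mul_eq_one, ← monodromy_mul, inv_mul_cancel, monodromy_one]
    rw [this, h]
    split_ifs <;> simp
  · rintro p q r ⟨Λ, s, hs, h⟩ ⟨Λ', s', hs', h'⟩
    refine ⟨Λ ∪ Λ', s * s', fun x hx => ?_, fun f => ?_⟩
    · rw [Finset.mem_union, not_or] at hx
      simp [hs x hx.1, hs' x hx.2]
    · rw [monodromy_mul, h, h']
      split_ifs <;> simp
  · intro i j
    -- the bond between the faces `(i, j)` and `(i + 1, j)`
    refine ⟨{⟨(i + 1, j), .up⟩}, fun x => if x = ⟨(i + 1, j), .up⟩ then c⁻¹ else 1,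
      fun x hx => by simp_all, fun f => ?_⟩
    obtain ⟨a, b⟩ := f
    simp only [monodromy, leftSide, rightSide, topSide, bottomSide, Prod.mk.injEq, Bond.mk.injEq]
    split_ifs <;> first | omega | simp_all
  · intro i j
    -- the bond between the faces `(i, j)` and `(i, j + 1)`
    refine ⟨{⟨(i, j + 1), .right⟩}, fun x => if x = ⟨(i, j + 1), .right⟩ then c else 1,
      fun x hx => by simp_all, fun f => ?_⟩
    obtain ⟨a, b⟩ := f
    simp only [monodromy, leftSide, rightSide, topSide, bottomSide, Prod.mk.injEq, Bond.mk.injEq]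
    split_ifs <;> first | omega | simp_all

variable [Fintype G] [DecidableEq G]

/-- A unitary string operator that moves the electric charge `χ` from `v` to `w`. -/
theorem exists_elecString (χ : Dual G) {v w : ℤ × ℤ} (hvw : v ≠ w) :
    ∃ (Λ : Finset Bond) (U : QLA G), U ∈ localAlg G Λ ∧ star U * U = 1 ∧
      U * elecCharge v χ = elecCharge v 1 * U ∧
      (∀ κ, U * elecCharge w κ = elecCharge w (κ * χ) * U) ∧
      (∀ u κ, u ≠ v → u ≠ w → Commute U (elecCharge u κ)) ∧
      ∀ f c, Commute U (magCharge f c) := by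
  obtain ⟨Λ, θ, hΛ, hθ⟩ := exists_holonomy (G := G) v w
  -- `U` is the operator of multiplication by `χ` of the holonomy from `v` to `w`.
  have hloc : ∀ σ : Bond → G, θ (extend Λ (restr Λ σ)) = θ σ := fun σ =>
    hΛ _ _ fun x hx => extend_restr_apply hx σ
  set U : QLA G := obs Λ (Matrix.diagonal fun a => (χ (θ (extend Λ a)) : ℂ)) with hU
  have hUd : IsDiag U fun σ => (χ (θ σ) : ℂ) := isDiag_obs_diagonal fun σ => by rw [hloc]
  have hUs : IsDiag (star U) fun σ => (χ (θ σ)⁻¹ : ℂ) := by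
    rw [hU, ← map_star, Matrix.star_eq_conjTranspose, Matrix.diagonal_conjTranspose]
    refine isDiag_obs_diagonal fun σ => ?_
    rw [Pi.star_apply, hloc, ← conj_character]
    rfl
  have hstar : ∀ u g, U * starOp u g = (χ (θ (gaugeElt u g)) : ℂ) • (starOp u g * U) := by
    intro u g
    refine ext_toOp fun ψ σ => ?_
    rw [toOp_smul_apply, toOp_mul_apply, toOp_mul_apply, hUd, isShift_starOp, isShift_starOp, hUd,
      ← mul_assoc, ← Units.val_mul, ← map_mul, ← map_mul, mul_inv_cancel_left]
  have hchg : ∀ u κ κ', (∀ g, (κ g)⁻¹ * χ (θ (gaugeElt u g)) = (κ' g)⁻¹) →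
      U * elecCharge u κ = elecCharge u κ' * U := by
    intro u κ κ' h
    simp only [elecCharge, mul_smul_comm, smul_mul_assoc, Finset.mul_sum, Finset.sum_mul, hstar,
      smul_smul]
    congr 1
    refine Finset.sum_congr rfl fun g _ => ?_
    rw [conj_character, conj_character, map_inv, map_inv, ← h g, Units.val_mul]
  refine ⟨Λ, U, obs_mem_localAlg _ _, ?_, hchg _ _ _ fun g => ?_, fun κ => hchg _ _ _ fun g => ?_,
    fun u κ hv hw => hchg _ _ _ fun g => ?_, fun f c => hUd.commute (isDiag_plaqOp f c)⟩
  · refine (hUs.mul hUd).eq (IsDiag.one.congr fun σ => ?_)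
    rw [← Units.val_mul, ← map_mul, inv_mul_cancel, map_one, Units.val_one]
  · simp [hθ, hvw]
  · simp [hθ, hvw.symm, mul_comm]
  · simp [hθ, hv, hw]

/-- A unitary string operator that moves the magnetic charge `c` from `p` to `q`. -/
theorem exists_magString (c : G) {p q : ℤ × ℤ} (hpq : p ≠ q) :
    ∃ (Λ : Finset Bond) (U : QLA G), U ∈ localAlg G Λ ∧ star U * U = 1 ∧
      U * magCharge p c = magCharge p 1 * U ∧
      (∀ d, U * magCharge q d = magCharge q (d * c) * U) ∧
      (∀ f d, f ≠ p → f ≠ q → Commute U (magCharge f d)) ∧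
      ∀ v χ, Commute U (elecCharge v χ) := by
  -- `U` shifts by a flux string that removes the monodromy `c` at `p` and adds it at `q`.
  obtain ⟨Λ, s, hs, h⟩ := exists_fluxString c⁻¹ p q
  set U : QLA G := obs Λ (moveMat Λ (s * ·)) with hU
  have hUs : IsShift U s := isShift_obs_moveMat (fun _ => rfl) hs
  have hUi : IsShift (star U) s⁻¹ := isShift_star_obs_moveMat (fun _ => rfl) hs
  have hchg : ∀ f d d', monodromy f s * d = d' → U * magCharge f d = magCharge f d' * U := by
    rintro f d d' rfl
    refine hUs.mul_isDiag (isDiag_plaqOp f _) (isDiag_plaqOp f _) fun σ => ?_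
    simp only [monodromy_mul, mul_right_inj]
  refine ⟨Λ, U, obs_mem_localAlg _ _, (hUi.mul hUs).eq (inv_mul_cancel s ▸ IsShift.one),
    hchg _ _ _ ?_, fun d => hchg _ _ _ ?_, fun f d hp hq => hchg _ _ _ ?_, fun v χ => ?_⟩
  · simp [h, hpq]
  · simp [h, hpq.symm, mul_comm]
  · simp [h, hp, hq]
  · exact (Commute.sum_right _ _ _ fun g _ =>
      (hUs.commute (isShift_starOp v g)).smul_right _).smul_right _

end Strings

/-! ### Ground states -/

section GroundStates

variable {G : Type*} [Fintype G] [DecidableEq G]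

/-- Positive functionals on a C*-algebra are continuous. -/
theorem continuous_of_isState {ω : QLA G →ₗ[ℂ] ℂ} (hω : IsState ω) : Continuous ω := by
  let _ : PartialOrder (QLA G) := CStarAlgebra.spectralOrder (QLA G)
  have : StarOrderedRing (QLA G) := CStarAlgebra.spectralOrderedRing (QLA G)
  let f : QLA G →ₚ[ℂ] ℂ := PositiveLinearMap.mk₀ ω fun a ha =>
    hω.1 a (CStarAlgebra.nonneg_iff_eq_star_mul_self.1 ha)
  exact map_continuous f

variable [CommGroup G]

theorem hamiltonian_eq (L : ℕ) : hamiltonian G (box L) =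
    ∑ v ∈ starsIn (box L), (1 - elecCharge v 1) + ∑ f ∈ facesIn (box L), (1 - magCharge f 1) := by
  simp only [hamiltonian, starTerm_eq, plaqTerm_eq]

/-- An eigenoperator of the dynamics that strictly lowers the energy annihilates ground states. -/
theorem IsGroundState.map_star_mul_self_eq_zero {ω : QLA G →ₗ[ℂ] ℂ} (hω : IsGroundState ω)
    {Λ : Finset Bond} {A : QLA G} (hA : A ∈ localAlg G Λ) {k : ℝ} (hk : 0 < k)
    (h : ∀ᶠ L in atTop,
      hamiltonian G (box L) * A - A * hamiltonian G (box L) = -((k : ℂ) • A)) :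
    ω (star A * A) = 0 := by
  have h1 : 0 ≤ ω (star A * -((k : ℂ) • A)) := by
    refine hω.2 A _ (subset_closure ⟨⟨Λ, hA⟩, ?_⟩)
    exact tendsto_const_nhds.congr' (h.mono fun L hL => hL.symm)
  rw [mul_neg, mul_smul_comm, map_neg, map_smul, smul_eq_mul] at h1
  have h2 : 0 ≤ ω (star A * A) := hω.1.1 _ ⟨A, rfl⟩
  have h3 : (k : ℂ) * ω (star A * A) ≤ 0 := neg_nonneg.1 h1
  have hk' : (0 : ℂ) < k := by exact_mod_cast hk
  have h4 := le_antisymm h3 (mul_nonneg hk'.le h2)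
  exact (mul_eq_zero.1 h4).resolve_left hk'.ne'

section Transport

variable {ι C A : Type*} [Fintype C] [DecidableEq C] [CommMonoid C] [DecidableEq ι]
  [Ring A] [StarRing A] [Algebra ℂ A] {P : ι → C → A}

/-- If `U` moves the charge `c` from `s` to `t`, where there is a charge `d`, the number of charges
decreases by one, or by two if the charges annihilate. -/
theorem IsChargeFamily.commutator_transport (hP : IsChargeFamily P) {U : A} {s t : ι} {c d : C}
    (hst : s ≠ t) (hc : c ≠ 1) (hd : d ≠ 1) (hs : U * P s c = P s 1 * U)
    (ht : U * P t d = P t (d * c) * U) (hU : ∀ u, u ≠ s → u ≠ t → Commute U (P u 1)) :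
    ∃ k : ℝ, 0 < k ∧ ∀ S : Finset ι, s ∈ S → t ∈ S →
      (∑ u ∈ S, (1 - P u 1)) * (U * (P s c * P t d))
        - U * (P s c * P t d) * ∑ u ∈ S, (1 - P u 1) = -((k : ℂ) • (U * (P s c * P t d))) := by
  refine ⟨if d * c = 1 then 2 else 1, by split_ifs <;> norm_num, fun S hsS htS => ?_⟩
  set X := U * (P s c * P t d) with hX
  have hX1 : X = P s 1 * (U * P t d) := by rw [hX, ← mul_assoc, hs, mul_assoc]
  have hX2 : X = P t (d * c) * (U * P s c) := by
    rw [hX, (hP.comm s c t d).eq, ← mul_assoc, ht, mul_assoc]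
  -- Only the positions `s` and `t` contribute: the charge leaves `s`, and `t` becomes neutral if
  -- and only if `d * c = 1`.
  have hterm : ∀ u, (1 - P u 1) * X - X * (1 - P u 1)
      = (if s = u then -X else 0) + if t = u then -(if d * c = 1 then X else 0) else 0 := by
    intro u
    have e : (1 - P u 1) * X - X * (1 - P u 1) = X * P u 1 - P u 1 * X := by noncomm_ring
    rw [e]
    by_cases h1 : s = u
    · subst h1
      have a1 : P s 1 * X = X := by rw [hX1, ← mul_assoc, hP.mul_eq, if_pos rfl]
      have a2 : X * P s 1 = 0 := by
        rw [hX, (hP.comm s c t d).eq, mul_assoc, mul_assoc, hP.mul_eq, if_neg hc, mul_zero,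
          mul_zero]
      rw [a1, a2, if_pos rfl, if_neg hst.symm]
      simp
    · by_cases h2 : t = u
      · subst h2
        have a1 : P t 1 * X = if d * c = 1 then X else 0 := by
          rw [hX2, ← mul_assoc, hP.mul_eq]
          by_cases h : d * c = 1
          · simp [h]
          · rw [if_neg h, if_neg (Ne.symm h), zero_mul]
        have a2 : X * P t 1 = 0 := by
          rw [hX, mul_assoc, mul_assoc, hP.mul_eq, if_neg hd, mul_zero, mul_zero]
        rw [a1, a2, if_neg hst, if_pos rfl]
        simp
      · have : Commute X (P u 1) :=
          (hU u (Ne.symm h1) (Ne.symm h2)).mul_left ((hP.comm _ _ _ _).mul_left (hP.comm _ _ _ _))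
        rw [if_neg h1, if_neg h2, this.eq, sub_self, add_zero]
  rw [Finset.sum_mul, Finset.mul_sum, ← Finset.sum_sub_distrib]
  simp only [hterm, Finset.sum_add_distrib, Finset.sum_ite_eq, hsS, htS, if_true]
  split_ifs
  · rw [Complex.ofReal_ofNat, two_smul, neg_add]
  · simp

end Transport

/-- In a ground state there are no two nontrivial electric charges: moving one of them onto the
other would lower the energy. -/
theorem IsGroundState.map_elecCharge_mul {ω : QLA G →ₗ[ℂ] ℂ} (hω : IsGroundState ω)
    {v w : ℤ × ℤ} {χ κ : Dual G} (hvw : v ≠ w) (hχ : χ ≠ 1) (hκ : κ ≠ 1) :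
    ω (elecCharge v χ * elecCharge w κ) = 0 := by
  classical
  have hP := isChargeFamily_elecCharge G
  obtain ⟨Λ, U, hUΛ, hU, h1, h2, h3, h4⟩ := exists_elecString χ hvw
  have htransport := hP.commutator_transport (U := U) hvw hχ hκ h1 (h2 κ)
    fun u hu hu' => h3 u 1 hu hu'
  obtain ⟨k, hk, hcomm⟩ := htransport
  rw [← hP.star_mul_self_unitary hU]
  refine hω.map_star_mul_self_eq_zero (mul_mem_localAlg_union hUΛ
    (mul_mem_localAlg_union (elecCharge_mem v χ) (elecCharge_mem w κ))) hk ?_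
  filter_upwards [eventually_mem_starsIn v, eventually_mem_starsIn w] with L hv hw
  have hmag : Commute (∑ f ∈ facesIn (box L), (1 - magCharge f (1 : G)))
      (U * (elecCharge v χ * elecCharge w κ)) :=
    Commute.sum_left _ _ _ fun f _ => (Commute.one_left _).sub_left
      ((h4 f 1).symm.mul_right ((commute_elecCharge_magCharge _ _ _ _).symm.mul_right
        (commute_elecCharge_magCharge _ _ _ _).symm))
  rw [hamiltonian_eq, add_mul, mul_add, add_sub_add_comm, hmag.eq, sub_self, add_zero]
  exact hcomm _ hv hw

/-- In a ground state there are no two nontrivial magnetic charges. -/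
theorem IsGroundState.map_magCharge_mul {ω : QLA G →ₗ[ℂ] ℂ} (hω : IsGroundState ω)
    {p q : ℤ × ℤ} {c d : G} (hpq : p ≠ q) (hc : c ≠ 1) (hd : d ≠ 1) :
    ω (magCharge p c * magCharge q d) = 0 := by
  have hP := isChargeFamily_magCharge G
  obtain ⟨Λ, U, hUΛ, hU, h1, h2, h3, h4⟩ := exists_magString c hpq
  have htransport := hP.commutator_transport (U := U) hpq hc hd h1 (h2 d)
    fun u hu hu' => h3 u 1 hu hu'
  obtain ⟨k, hk, hcomm⟩ := htransport
  rw [← hP.star_mul_self_unitary hU]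
  refine hω.map_star_mul_self_eq_zero (mul_mem_localAlg_union hUΛ
    (mul_mem_localAlg_union (plaqOp_mem p c) (plaqOp_mem q d))) hk ?_
  filter_upwards [eventually_mem_facesIn p, eventually_mem_facesIn q] with L hp hq
  have helec : Commute (∑ v ∈ starsIn (box L), (1 - elecCharge v (1 : Dual G)))
      (U * (magCharge p c * magCharge q d)) :=
    Commute.sum_left _ _ _ fun v _ => (Commute.one_left _).sub_left
      ((h4 v 1).symm.mul_right ((commute_elecCharge_magCharge _ _ _ _).mul_right
        (commute_elecCharge_magCharge _ _ _ _)))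
  rw [hamiltonian_eq, add_mul, mul_add, add_sub_add_comm, helec.eq, sub_self, zero_add]
  exact hcomm _ hp hq

end GroundStates

/-! ### Ribbon operators -/

section Ribbons

variable {G : Type*} [CommGroup G]

/-- The configuration by which the triangles of a ribbon shift, for the flux `h`. -/
def Triangle.crossElt (h : G) : Triangle → Bond → G
  | .direct _ _ _ => 1
  | .dual x _ fwd => Pi.mulSingle x (if fwd then h else h⁻¹)

/-- The contribution of a triangle to the holonomy along a ribbon. -/
def Triangle.holonomy (σ : Bond → G) : Triangle → G
  | .direct x _ fwd => if fwd then σ x else (σ x)⁻¹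
  | .dual _ _ _ => 1

variable [Fintype G] [DecidableEq G]

theorem isDiag_op_direct (x : Bond) (f : ℤ × ℤ) (fwd : Bool) (h g : G) :
    IsDiag ((Triangle.direct x f fwd).op h g)
      fun σ => if (Triangle.direct x f fwd).holonomy σ = g then 1 else 0 :=
  isDiag_obs_projMat fun σ => by
    rw [extend_restr_apply (Finset.mem_singleton_self x)]

theorem isShift_op_dual (x : Bond) (v : ℤ × ℤ) (fwd : Bool) (h : G) :
    IsShift ((Triangle.dual x v fwd).op h 1) ((Triangle.dual x v fwd).crossElt h) := by
  rw [Triangle.op, if_pos rfl]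
  refine isShift_obs_moveMat (fun c => ?_) fun y hy => ?_
  · funext y
    by_cases hy : y = x
    · subst hy
      simp [Triangle.crossElt]
    · simp [Triangle.crossElt, hy]
  · exact Pi.mulSingle_eq_of_ne (by simpa using hy) _

theorem op_dual_of_ne (x : Bond) (v : ℤ × ℤ) (fwd : Bool) (h : G) {g : G} (hg : g ≠ 1) :
    (Triangle.dual x v fwd).op h g = 0 := by
  rw [Triangle.op, if_neg hg]

theorem isShift_sum_op (τ : Triangle) (h : G) : IsShift (∑ g, τ.op h g) (τ.crossElt h) := by
  cases τ with
  | direct x f fwd =>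
    have : ∑ g, (Triangle.direct x f fwd).op h g = 1 :=
      (IsDiag.sum fun g => isDiag_op_direct x f fwd h g).eq (IsDiag.one.congr fun σ => by simp)
    rw [this]
    exact IsShift.one
  | dual x v fwd =>
    rw [Fintype.sum_eq_single 1 fun g hg => op_dual_of_ne x v fwd h hg]
    exact isShift_op_dual x v fwd h

theorem isDiag_op_one (τ : Triangle) (g : G) :
    IsDiag (τ.op 1 g) fun σ => if τ.holonomy σ = g then 1 else 0 := by
  cases τ with
  | direct x f fwd => exact isDiag_op_direct x f fwd 1 g
  | dual x v fwd =>
    by_cases hg : g = 1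
    · subst hg
      have h1 := isShift_op_dual x v fwd (1 : G)
      have e : (Triangle.dual x v fwd).crossElt (1 : G) = 1 := by simp [Triangle.crossElt]
      rw [h1.eq (e ▸ IsShift.one)]
      exact IsDiag.one.congr fun σ => by simp [Triangle.holonomy]
    · rw [op_dual_of_ne x v fwd 1 hg]
      exact IsDiag.zero.congr fun σ => by simp [Triangle.holonomy, Ne.symm hg]

/-- Summed over its holonomy, a ribbon operator transports the flux across the ribbon. -/
theorem isShift_sum_ribbonOp (ρ : List Triangle) (h : G) :
    IsShift (∑ g, ribbonOp ρ h g) (ρ.map (Triangle.crossElt h)).prod := by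
  induction ρ with
  | nil => simpa [ribbonOp] using IsShift.one
  | cons τ ρ ih =>
    have e : ∑ g, ribbonOp (τ :: ρ) h g = (∑ k, τ.op h k) * ∑ g, ribbonOp ρ h g := by
      simp only [ribbonOp]
      rw [Finset.sum_comm, Finset.sum_mul]
      refine Finset.sum_congr rfl fun k _ => ?_
      rw [← Finset.mul_sum]
      congr 1
      exact Equiv.sum_comp (Equiv.mulLeft k⁻¹) (ribbonOp ρ h)
    rw [e, List.map_cons, List.prod_cons]
    exact (isShift_sum_op τ h).mul ih

/-- Without flux, a ribbon operator is the projection onto the given holonomy. -/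
theorem isDiag_ribbonOp_one (ρ : List Triangle) (g : G) :
    IsDiag (ribbonOp ρ 1 g) fun σ => if (ρ.map (Triangle.holonomy σ)).prod = g then 1 else 0 := by
  induction ρ generalizing g with
  | nil =>
    rw [ribbonOp]
    split_ifs with h
    · exact IsDiag.one.congr fun σ => by simp [h]
    · exact IsDiag.zero.congr fun σ => by simp [Ne.symm h]
  | cons τ ρ ih =>
    rw [ribbonOp]
    refine (IsDiag.sum fun k => (isDiag_op_one τ k).mul (ih (k⁻¹ * g))).congr fun σ => ?_
    rw [Finset.sum_eq_single (τ.holonomy σ) (fun k _ hk => by rw [if_neg hk.symm, zero_mul])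
      (by simp)]
    simp [eq_inv_mul_iff_mul_eq]

theorem op_mem (τ : Triangle) (h g : G) : τ.op h g ∈ localAlg G {τ.bond} := by
  cases τ with
  | direct x f fwd => exact obs_mem_localAlg _ _
  | dual x v fwd =>
    rw [Triangle.op]
    by_cases hg : g = 1
    · rw [if_pos hg]
      exact obs_mem_localAlg _ _
    · rw [if_neg hg]
      exact zero_mem (localAlg G _)

theorem ribbonOp_mem {Λ : Finset Bond} {ρ : List Triangle} (hρ : ∀ τ ∈ ρ, τ.bond ∈ Λ) (h g : G) :
    ribbonOp ρ h g ∈ localAlg G Λ := by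
  induction ρ generalizing g with
  | nil =>
    rw [ribbonOp]
    split_ifs
    · exact one_mem _
    · exact zero_mem _
  | cons τ ρ ih =>
    rw [ribbonOp]
    refine sum_mem fun k _ => mul_mem ?_ (ih (fun τ' h' => hρ τ' (List.mem_cons_of_mem _ h')) _)
    exact localAlg_mono (by simpa using hρ τ List.mem_cons_self) (op_mem τ h k)

theorem chargeRibbonOp_mem {Λ : Finset Bond} {ρ : List Triangle} (hρ : ∀ τ ∈ ρ, τ.bond ∈ Λ)
    (χ : Dual G) (c : G) : chargeRibbonOp ρ χ c ∈ localAlg G Λ :=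
  sum_mem fun g _ => SMulMemClass.smul_mem _ (ribbonOp_mem hρ _ g)

end Ribbons

/-! ### The boundary ribbon -/

section Boundary

/-- One side of the boundary ribbon: `n` direct triangles, and a dual triangle before each of them
but the first. -/
def ribbonSide (n : ℕ) (across along : ℤ → Triangle) : List Triangle :=
  (List.range n).flatMap fun k : ℕ => if k = 0 then [along k] else [across k, along k]

theorem boundaryRibbon_eq (L : ℕ) : boundaryRibbon L =
    ribbonSide (2 * L)
      (fun k => .dual ⟨(-(L : ℤ) + k, -(L : ℤ)), .up⟩ (-(L : ℤ) + k, -(L : ℤ)) true)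
      (fun k => .direct ⟨(-(L : ℤ) + k, -(L : ℤ)), .right⟩ (-(L : ℤ) + k, -(L : ℤ)) true) ++
    ribbonSide (2 * L)
      (fun k => .dual ⟨((L : ℤ) - 1, -(L : ℤ) + k), .right⟩ (L, -(L : ℤ) + k) false)
      (fun k => .direct ⟨(L, -(L : ℤ) + k), .up⟩ ((L : ℤ) - 1, -(L : ℤ) + k) true) ++
    ribbonSide (2 * L)
      (fun k => .dual ⟨((L : ℤ) - k, (L : ℤ) - 1), .up⟩ ((L : ℤ) - k, L) false)
      (fun k => .direct ⟨((L : ℤ) - k - 1, L), .right⟩ ((L : ℤ) - k - 1, (L : ℤ) - 1) false) ++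
    ribbonSide (2 * L)
      (fun k => .dual ⟨(-(L : ℤ), (L : ℤ) - k), .right⟩ (-(L : ℤ), (L : ℤ) - k) true)
      (fun k => .direct ⟨(-(L : ℤ), (L : ℤ) - k - 1), .up⟩ (-(L : ℤ), (L : ℤ) - k - 1) false) := by
  simp [boundaryRibbon, ribbonSide, List.flatMap_assoc]

variable {across along : ℤ → Triangle}

theorem mem_ribbonSide {n : ℕ} {τ : Triangle} : τ ∈ ribbonSide n across along ↔
    ∃ k : ℕ, k < n ∧ (0 < k ∧ τ = across k ∨ τ = along k) := by
  simp only [ribbonSide, List.mem_flatMap, List.mem_range]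
  refine exists_congr fun k => and_congr_right fun _ => ?_
  rcases Nat.eq_zero_or_pos k with rfl | hk
  · simp
  · simp [hk, hk.ne']

theorem exists_of_mem_map_bond {n : ℕ} {x : Bond}
    (h : x ∈ (ribbonSide n across along).map Triangle.bond) :
    ∃ k : ℕ, k < n ∧ (0 < k ∧ x = (across k).bond ∨ x = (along k).bond) := by
  obtain ⟨τ, hτ, rfl⟩ := List.mem_map.1 h
  obtain ⟨k, hk, ⟨h0, rfl⟩ | rfl⟩ := mem_ribbonSide.1 hτ
  · exact ⟨k, hk, .inl ⟨h0, rfl⟩⟩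
  · exact ⟨k, hk, .inr rfl⟩

theorem ribbonSide_succ (n : ℕ) : ribbonSide (n + 1) across along =
    ribbonSide n across along ++ if n = 0 then [along n] else [across n, along n] := by
  simp [ribbonSide, List.range_succ, List.flatMap_append]

theorem getLast?_ribbonSide (n : ℕ) :
    (ribbonSide (n + 1) across along).getLast? = some (along n) := by
  rw [ribbonSide_succ, List.getLast?_append]
  split_ifs <;> simp

theorem head?_ribbonSide (n : ℕ) : (ribbonSide (n + 1) across along).head? = some (along 0) := by
  simp [ribbonSide, List.range_succ_eq_map]

theorem isChain_ribbonSide {R : Triangle → Triangle → Prop} (n : ℕ)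
    (h1 : ∀ k, R (along k) (across (k + 1))) (h2 : ∀ k, R (across k) (along k)) :
    (ribbonSide n across along).IsChain R := by
  induction n with
  | zero => exact List.isChain_nil
  | succ n ih =>
    rw [ribbonSide_succ]
    cases n with
    | zero => simp [ribbonSide]
    | succ n =>
      rw [if_neg n.succ_ne_zero]
      refine ih.append (by simpa using h2 _) ?_
      rw [getLast?_ribbonSide]
      simpa using h1 n

theorem nodup_ribbonSide (n : ℕ) (h1 : Function.Injective fun k => (across k).bond)
    (h2 : Function.Injective fun k => (along k).bond)
    (h3 : ∀ j k, (across j).bond ≠ (along k).bond) :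
    ((ribbonSide n across along).map Triangle.bond).Nodup := by
  induction n with
  | zero => exact List.nodup_nil
  | succ n ih =>
    rw [ribbonSide_succ, List.map_append]
    refine ih.append (by split_ifs <;> simp [h3]) ?_
    rw [List.disjoint_left]
    intro x hx hx'
    obtain ⟨τ, hτ, rfl⟩ := List.mem_map.1 hx
    obtain ⟨τ', hτ', he⟩ := List.mem_map.1 hx'
    obtain ⟨k, hk, hk'⟩ := mem_ribbonSide.1 hτ
    have hn : τ' = across n ∨ τ' = along n := by
      split_ifs at hτ' with h <;> simp at hτ' <;> tauto
    have hkn : (n : ℤ) ≠ k := by omega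
    rcases hn with rfl | rfl <;> rcases hk' with ⟨_, rfl⟩ | rfl
    · exact hkn (h1 he)
    · exact h3 _ _ he
    · exact h3 _ _ he.symm
    · exact hkn (h2 he)

theorem prod_map_ribbonSide {M : Type*} [CommMonoid M] (F : Triangle → M) (n : ℕ) :
    ((ribbonSide n across along).map F).prod =
      (∏ k ∈ Finset.range n, if k = 0 then 1 else F (across k)) *
        ∏ k ∈ Finset.range n, F (along k) := by
  induction n with
  | zero => simp [ribbonSide]
  | succ n ih =>
    rw [ribbonSide_succ, List.map_append, List.prod_append, ih, Finset.prod_range_succ,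
      Finset.prod_range_succ]
    split_ifs
    · simp [mul_assoc]
    · simp only [List.map_cons, List.map_nil, List.prod_cons, List.prod_nil, mul_one]
      exact mul_mul_mul_comm _ _ _ _

theorem isClosedRibbon_boundaryRibbon {L : ℕ} (hL : 2 ≤ L) : IsClosedRibbon (boundaryRibbon L) := by
  obtain ⟨n, hn⟩ : ∃ n, 2 * L = n + 1 := ⟨2 * L - 1, by omega⟩
  have hnZ : (2 : ℤ) * L = n + 1 := by exact_mod_cast hn
  rw [boundaryRibbon_eq]
  refine ⟨?_, ?_, ?_, ?_, ?_⟩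
  · rw [hn]
    simp only [ribbonSide_succ, List.length_append]
    split_ifs <;> simp <;> omega
  · intro τ hτ
    simp only [List.mem_append, mem_ribbonSide] at hτ
    obtain ((⟨k, hk, ⟨_, rfl⟩ | rfl⟩ | ⟨k, hk, ⟨_, rfl⟩ | rfl⟩) | ⟨k, hk, ⟨_, rfl⟩ | rfl⟩) |
      ⟨k, hk, ⟨_, rfl⟩ | rfl⟩ := hτ <;>
    simp [Triangle.Valid, mem_starBonds, plaquette, leftSide, rightSide, topSide, bottomSide,
      Bond.tgt]
  · rw [hn]
    refine List.IsChain.append (List.IsChain.append (List.IsChain.append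
      (isChain_ribbonSide _ ?_ ?_) (isChain_ribbonSide _ ?_ ?_) ?_)
      (isChain_ribbonSide _ ?_ ?_) ?_) (isChain_ribbonSide _ ?_ ?_) ?_ <;>
    (try simp only [List.getLast?_append, getLast?_ribbonSide, head?_ribbonSide, Option.some_or,
      Option.mem_some_iff, forall_eq']) <;>
    intros <;>
    simp only [Triangle.start, Triangle.finish, Bond.tgt, Bond.cwFace, Bond.ccwFace, Prod.mk.injEq,
      if_true, Bool.false_eq_true, if_false, and_true, true_and] <;>
    omega
  · simp only [List.map_append]
    have hdisj : ∀ {a b c d : ℤ → Triangle},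
        (∀ j k : ℕ, j < 2 * L → k < 2 * L →
          ((0 < j → 0 < k → (a j).bond ≠ (c k).bond) ∧ (0 < j → (a j).bond ≠ (d k).bond)) ∧
          (0 < k → (b j).bond ≠ (c k).bond) ∧ (b j).bond ≠ (d k).bond) →
        List.Disjoint ((ribbonSide (2 * L) a b).map Triangle.bond)
          ((ribbonSide (2 * L) c d).map Triangle.bond) := by
      intro a b c d h
      rw [List.disjoint_left]
      intro x hx hx'
      obtain ⟨j, hj, h1⟩ := exists_of_mem_map_bond hx
      obtain ⟨k, hk, h2⟩ := exists_of_mem_map_bond hx'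
      obtain ⟨⟨e1, e2⟩, e3, e4⟩ := h j k hj hk
      rcases h1 with ⟨hj0, rfl⟩ | rfl <;> rcases h2 with ⟨hk0, h2⟩ | h2
      · exact e1 hj0 hk0 h2
      · exact e2 hj0 h2
      · exact e3 hk0 h2
      · exact e4 h2
    refine List.Nodup.append (List.Nodup.append (List.Nodup.append
      (nodup_ribbonSide _ ?_ ?_ ?_) (nodup_ribbonSide _ ?_ ?_ ?_) (hdisj ?_))
      (nodup_ribbonSide _ ?_ ?_ ?_) (List.disjoint_append_left.2 ⟨hdisj ?_, hdisj ?_⟩))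
      (nodup_ribbonSide _ ?_ ?_ ?_) (List.disjoint_append_left.2
        ⟨List.disjoint_append_left.2 ⟨hdisj ?_, hdisj ?_⟩, hdisj ?_⟩)
    all_goals first
      | exact fun j k h => Dir.noConfusion (congrArg Bond.dir h)
      | (intro j k h
         simp only [Triangle.bond, Bond.mk.injEq, Prod.mk.injEq, and_true, true_and] at h
         omega)
      | (intro j k hj hk
         simp only [Triangle.bond, ne_eq, Bond.mk.injEq, Prod.mk.injEq, and_true, true_and,
           reduceCtorEq, and_false, not_false_eq_true, implies_true]
         omega)
  · rw [hn]
    simp only [List.head?_append, List.getLast?_append, getLast?_ribbonSide, head?_ribbonSide,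
      Option.some_or, Option.map_some, Option.some_inj, Triangle.start, Triangle.finish,
      Prod.mk.injEq, if_true, Bool.false_eq_true, if_false]
    omega

end Boundary

/-! ### Total charges and the boundary ribbon -/

section BoundaryCharge

variable {G : Type*} [CommGroup G]

theorem prod_gaugeElt_apply (S : Finset (ℤ × ℤ)) (g : G) (x : Bond) :
    (∏ v ∈ S, gaugeElt v g) x
      = (if x.src ∈ S then g else 1) * if x.tgt ∈ S then g⁻¹ else 1 := by
  have hne : x.src ≠ x.tgt := by
    obtain ⟨⟨a, b⟩, d⟩ := x
    cases d <;> simp [Bond.tgt]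
  have e : ∀ v, gaugeElt v g x = (if x.src = v then g else 1) * if x.tgt = v then g⁻¹ else 1 := by
    intro v
    rw [gaugeElt]
    by_cases h : x.src = v
    · rw [if_pos h, if_pos h, if_neg fun h' => hne (h.trans h'.symm), mul_one]
    · rw [if_neg h, if_neg h, one_mul]
  rw [Finset.prod_apply]
  simp only [e, Finset.prod_mul_distrib, Finset.prod_ite_eq]

/-- A product of shifts of the distinct bonds `b 1, …, b (n - 1)`, evaluated at a bond. -/
theorem prod_mulSingle_apply {b : ℕ → Bond} (hb : Function.Injective b) (n : ℕ) (a : G) (x : Bond)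
    (p : Prop) [Decidable p] (hp : p ↔ ∃ k, 0 < k ∧ k < n ∧ x = b k) :
    (∏ k ∈ Finset.range n, if k = 0 then 1 else Pi.mulSingle (b k) a : Bond → G) x
      = if p then a else 1 := by
  rw [Finset.prod_apply]
  have e : ∀ k, (if k = 0 then 1 else Pi.mulSingle (b k) a : Bond → G) x
      = if 0 < k ∧ x = b k then a else 1 := by
    intro k
    rcases Nat.eq_zero_or_pos k with rfl | hk
    · simp
    · rw [if_neg hk.ne']
      by_cases hx : x = b k
      · rw [if_pos ⟨hk, hx⟩, hx, Pi.mulSingle_eq_same]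
      · rw [if_neg fun h => hx h.2, Pi.mulSingle_eq_of_ne hx]
  simp only [e]
  split_ifs with h
  · obtain ⟨k, h0, hk, rfl⟩ := hp.1 h
    rw [Finset.prod_eq_single k, if_pos ⟨h0, rfl⟩]
    · intro j _ hj
      rw [if_neg fun h' => hj (hb h'.2).symm]
    · exact fun h' => absurd (Finset.mem_range.2 hk) h'
  · refine Finset.prod_eq_one fun k hk => if_neg fun h' => h (hp.2 ?_)
    exact ⟨k, h'.1, Finset.mem_range.1 hk, h'.2⟩

/-- The gauge transformations at all inner vertices of the square cancel on the inner bonds; what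
remains is the shift across the boundary ribbon. -/
theorem prod_crossElt_boundaryRibbon {L : ℕ} (hL : 2 ≤ L) (g : G) :
    ((boundaryRibbon L).map (Triangle.crossElt g⁻¹)).prod
      = ∏ v ∈ starsIn (box L), gaugeElt v g := by
  funext x
  rw [prod_gaugeElt_apply, boundaryRibbon_eq]
  simp only [List.map_append, List.prod_append, prod_map_ribbonSide, Triangle.crossElt, if_true,
    Bool.false_eq_true, if_false, inv_inv, Finset.prod_const_one, mul_one, Pi.mul_apply]
  obtain ⟨⟨a, b⟩, d⟩ := x
  -- the shifts along the bottom, right, top and left side of the square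
  rw [prod_mulSingle_apply (b := fun k : ℕ => ⟨(-(L : ℤ) + k, -(L : ℤ)), .up⟩) ?_ _ _ _
      (d = .up ∧ b = -L ∧ -L < a ∧ a < L) ?_,
    prod_mulSingle_apply (b := fun k : ℕ => ⟨((L : ℤ) - 1, -(L : ℤ) + k), .right⟩) ?_ _ _ _
      (d = .right ∧ a = L - 1 ∧ -L < b ∧ b < L) ?_,
    prod_mulSingle_apply (b := fun k : ℕ => ⟨((L : ℤ) - k, (L : ℤ) - 1), .up⟩) ?_ _ _ _
      (d = .up ∧ b = L - 1 ∧ -L < a ∧ a < L) ?_,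
    prod_mulSingle_apply (b := fun k : ℕ => ⟨(-(L : ℤ), (L : ℤ) - k), .right⟩) ?_ _ _ _
      (d = .right ∧ a = -L ∧ -L < b ∧ b < L) ?_]
  · simp only [mem_starsIn_box]
    cases d <;> simp only [Bond.tgt, reduceCtorEq, false_and, true_and, if_false, mul_one, one_mul]
    all_goals
      split_ifs <;> first | omega | (simp; done) | (simp; intros; exfalso; omega)
  all_goals first
    | (intro j k h
       simp only [Bond.mk.injEq, Prod.mk.injEq, and_true, true_and] at h
       omega)
    | (simp only [Bond.mk.injEq, Prod.mk.injEq]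
       constructor
       · rintro ⟨rfl, h1, h2, h3⟩
         first
           | exact ⟨(a + L).toNat, by omega, by omega, ⟨by omega, by omega⟩, rfl⟩
           | exact ⟨(b + L).toNat, by omega, by omega, ⟨by omega, by omega⟩, rfl⟩
           | exact ⟨(L - a).toNat, by omega, by omega, ⟨by omega, by omega⟩, rfl⟩
           | exact ⟨(L - b).toNat, by omega, by omega, ⟨by omega, by omega⟩, rfl⟩
       · rintro ⟨k, h0, hk, ⟨h1, h2⟩, rfl⟩
         exact ⟨rfl, by omega, by omega, by omega⟩)

/-- Discrete Stokes theorem: the product of the monodromies of all faces of the square is the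
inverse of the holonomy along the boundary ribbon, which runs counterclockwise. -/
theorem prod_holonomy_boundaryRibbon (L : ℕ) (σ : Bond → G) :
    ((boundaryRibbon L).map (Triangle.holonomy σ)).prod
      = (∏ f ∈ facesIn (box L), monodromy f σ)⁻¹ := by
  have hfaces : ∏ f ∈ facesIn (box L), monodromy f σ
      = ∏ i ∈ Finset.range (2 * L), ∏ j ∈ Finset.range (2 * L),
        monodromy (-(L : ℤ) + i, -(L : ℤ) + j) σ := by
    rw [← Finset.prod_product']
    symm
    refine Finset.prod_bij (fun p _ => (-(L : ℤ) + p.1, -(L : ℤ) + p.2)) ?_ ?_ ?_ ?_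
    · intro p hp
      simp only [Finset.mem_product, Finset.mem_range] at hp
      rw [mem_facesIn_box]
      dsimp only
      omega
    · rintro ⟨i, j⟩ _ ⟨i', j'⟩ _ h
      simp only [Prod.mk.injEq] at h ⊢
      omega
    · rintro ⟨a, b⟩ h
      rw [mem_facesIn_box] at h
      refine ⟨((a + L).toNat, (b + L).toNat), ?_, ?_⟩
      · simp only [Finset.mem_product, Finset.mem_range]
        omega
      · simp only [Prod.mk.injEq]
        omega
    · intro p _
      rfl
  -- In the coordinates of the square the products of the monodromies over rows and columns
  -- telescope.
  set u : ℕ → ℕ → G := fun i j => σ ⟨(-(L : ℤ) + i, -(L : ℤ) + j), .up⟩ with hu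
  set r : ℕ → ℕ → G := fun i j => σ ⟨(-(L : ℤ) + i, -(L : ℤ) + j), .right⟩ with hr
  have hm : ∀ i j : ℕ, monodromy (-(L : ℤ) + i, -(L : ℤ) + j) σ
      = (u i j / u (i + 1) j) * (r i (j + 1) / r i j) := by
    intro i j
    simp only [monodromy, leftSide, rightSide, topSide, bottomSide, hu, hr, Nat.cast_add,
      Nat.cast_one, add_assoc, div_eq_mul_inv]
    simp only [mul_assoc, mul_left_comm, mul_comm]
  have hL2 : (((2 * L : ℕ) : ℤ)) = 2 * (L : ℤ) := by push_cast; rfl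
  rw [hfaces]
  simp only [hm, Finset.prod_mul_distrib]
  rw [Finset.prod_comm]
  simp only [Finset.prod_range_div, Finset.prod_range_div']
  rw [boundaryRibbon_eq]
  simp only [List.map_append, List.prod_append, prod_map_ribbonSide, Triangle.holonomy, if_true,
    Bool.false_eq_true, if_false, ite_self, Finset.prod_const_one, one_mul,
    Finset.prod_div_distrib, Finset.prod_inv_distrib]
  have hbottom : ∀ k : ℕ, σ ⟨(-(L : ℤ) + k, -(L : ℤ)), .right⟩ = r k 0 := fun k => by simp [hr]
  have hright : ∀ k : ℕ, σ ⟨((L : ℤ), -(L : ℤ) + k), .up⟩ = u (2 * L) k := fun k => by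
    simp only [hu, hL2]
    congr 3
    omega
  have htop : ∏ k ∈ Finset.range (2 * L), σ ⟨((L : ℤ) - k - 1, L), .right⟩
      = ∏ k ∈ Finset.range (2 * L), r k (2 * L) := by
    rw [← Finset.prod_range_reflect]
    refine Finset.prod_congr rfl fun k hk => ?_
    rw [Finset.mem_range] at hk
    simp only [hr]
    congr 3 <;> omega
  have hleft : ∏ k ∈ Finset.range (2 * L), σ ⟨(-(L : ℤ), (L : ℤ) - k - 1), .up⟩
      = ∏ k ∈ Finset.range (2 * L), u 0 k := by
    rw [← Finset.prod_range_reflect]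
    refine Finset.prod_congr rfl fun k hk => ?_
    rw [Finset.mem_range] at hk
    simp only [hu]
    congr 3 <;> omega
  simp only [hbottom, hright, htop, hleft]
  generalize (∏ k ∈ Finset.range (2 * L), r k 0) = r₀,
    (∏ k ∈ Finset.range (2 * L), r k (2 * L)) = r₁,
    (∏ k ∈ Finset.range (2 * L), u 0 k) = u₀, (∏ k ∈ Finset.range (2 * L), u (2 * L) k) = u₁
  simp only [div_eq_mul_inv, mul_inv, inv_inv]
  simp only [mul_assoc, mul_left_comm, mul_comm]

variable [Fintype G] [DecidableEq G]

/-- The electric charge projectors of the square. -/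
abbrev boxElec (L : ℕ) : starsIn (box L) → Dual G → QLA G := fun v => elecCharge v.1

/-- The magnetic charge projectors of the square. -/
abbrev boxMag (L : ℕ) : facesIn (box L) → G → QLA G := fun f => magCharge f.1

end BoundaryCharge

/-! ### The boundary terms -/

section BoundaryTerms

variable {ι C A : Type*} [Fintype C] [DecidableEq C] [Ring A] [StarRing A] [Fintype ι]
  [DecidableEq ι] [CommMonoid C] {P : ι → C → A}

/-- The projectors onto given nontrivial total charge add up to the complement of the projector onto
trivial total charge. -/
theorem IsChargeFamily.sum_ne_one (hP : IsChargeFamily P) :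
    ∑ c with c ≠ 1, ∑ κ with ∏ s, κ s = c, fullSector P κ
      = 1 - ∑ κ with ∏ s, κ s = 1, fullSector P κ := by
  rw [eq_sub_iff_add_eq, Finset.filter_ne', Finset.sum_erase_add _ _ (Finset.mem_univ _),
    Finset.sum_fiberwise, hP.sum_fullSector]

end BoundaryTerms

section BoundaryOperators

variable {G : Type*} [CommGroup G] [Fintype G] [DecidableEq G]

theorem isChargeFamily_boxElec [DecidableEq (Dual G)] (L : ℕ) :
    IsChargeFamily (boxElec (G := G) L) := (isChargeFamily_elecCharge G).comp Subtype.val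

theorem isChargeFamily_boxMag (L : ℕ) : IsChargeFamily (boxMag (G := G) L) :=
  (isChargeFamily_magCharge G).comp Subtype.val

theorem elecBoundary_eq [DecidableEq (Dual G)] (L : ℕ) : elecBoundary G L
    = 1 - ∑ κ with ∏ v, κ v = 1, fullSector (boxElec (G := G) L) κ := by
  rw [← (isChargeFamily_boxElec L).sum_ne_one]
  unfold elecBoundary totalElec
  congr!

theorem magBoundary_eq (L : ℕ) : magBoundary G L
    = 1 - ∑ κ with ∏ f, κ f = 1, fullSector (boxMag (G := G) L) κ := by
  rw [← (isChargeFamily_boxMag L).sum_ne_one]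
  unfold magBoundary totalMag
  congr!

theorem excessOp_boxElec [DecidableEq (Dual G)] (L : ℕ) : excessOp (boxElec (G := G) L)
    = ∑ v ∈ starsIn (box L), (1 - elecCharge v 1) - elecBoundary G L := by
  rw [excessOp, elecBoundary_eq,
    Finset.sum_coe_sort (starsIn (box L)) fun v => (1 - elecCharge v (1 : Dual G))]

theorem excessOp_boxMag (L : ℕ) : excessOp (boxMag (G := G) L)
    = ∑ f ∈ facesIn (box L), (1 - magCharge f 1) - magBoundary G L := by
  rw [excessOp, magBoundary_eq,
    Finset.sum_coe_sort (facesIn (box L)) fun f => (1 - magCharge f (1 : G))]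

/-- The Hamiltonian with the boundary terms is the sum of the two excess operators. -/
theorem hamiltonian_sub_boundary [DecidableEq (Dual G)] (L : ℕ) :
    hamiltonian G (box L) - elecBoundary G L - magBoundary G L
      = excessOp (boxElec (G := G) L) + excessOp (boxMag (G := G) L) := by
  rw [hamiltonian_eq, excessOp_boxElec, excessOp_boxMag]
  abel

/-- The product of the gauge transformations by `g` at all inner vertices of the square. -/
def globalStarOp (L : ℕ) (g : G) : QLA G :=
  ((Finset.univ : Finset (starsIn (box L))).toList.map fun v => starOp v.1 g).prod

theorem isShift_globalStarOp (L : ℕ) (g : G) :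
    IsShift (globalStarOp L g) (∏ v ∈ starsIn (box L), gaugeElt v g) := by
  have h := IsShift.list_prod (l := (Finset.univ : Finset (starsIn (box L))).toList)
    fun v => isShift_starOp v.1 g
  rwa [Finset.prod_map_toList, Finset.prod_coe_sort (starsIn (box L)) fun v => gaugeElt v g] at h

/-- The global gauge transformations measure the total charge. -/
theorem globalStarOp_mul_fullSector (L : ℕ) (g : G) (κ : starsIn (box L) → Dual G) :
    globalStarOp L g * fullSector (boxElec L) κ
      = (((∏ v, κ v) g : ℂˣ) : ℂ) • fullSector (boxElec L) κ := by
  classical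
  have hP := isChargeFamily_boxElec (G := G) L
  have h1 : ∀ v, starOp v.1 g * fullSector (boxElec L) κ
      = ((κ v g : ℂˣ) : ℂ) • fullSector (boxElec L) κ := by
    intro v
    have h := hP.mul_fullSector v (κ v) κ
    rw [if_pos rfl] at h
    rw [← h, ← mul_assoc, starOp_mul_elecCharge, smul_mul_assoc]
  have h2 : ∀ l : List (starsIn (box L)),
      (l.map fun v => starOp v.1 g).prod * fullSector (boxElec L) κ
        = (l.map fun v => ((κ v g : ℂˣ) : ℂ)).prod • fullSector (boxElec L) κ := by
    intro l
    induction l with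
    | nil => simp
    | cons v l ih =>
      rw [List.map_cons, List.prod_cons, mul_assoc, ih, mul_smul_comm, h1, smul_smul, List.map_cons,
        List.prod_cons, mul_comm]
  rw [globalStarOp, h2, Finset.prod_map_toList, MonoidHom.finsetProd_apply, Units.coe_prod]

/-- The projector onto trivial total electric charge is the average of the global gauge
transformations. -/
theorem sum_fullSector_boxElec [DecidableEq (Dual G)] (L : ℕ) :
    ∑ κ with ∏ v, κ v = 1, fullSector (boxElec (G := G) L) κ
      = (Fintype.card G : ℂ)⁻¹ • ∑ g, globalStarOp L g := by
  have hP := isChargeFamily_boxElec (G := G) L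
  refine hP.ext_sector fun κ => ?_
  rw [hP.sum_neutral_mul, smul_mul_assoc, Finset.sum_mul]
  simp only [globalStarOp_mul_fullSector]
  rw [← Finset.sum_smul, sum_character, smul_smul]
  by_cases h : ∏ v, κ v = 1
  · rw [if_pos h, if_pos h, inv_mul_cancel₀ card_cast_ne_zero, one_smul]
  · rw [if_neg h, if_neg h, mul_zero, zero_smul]

theorem inv_card_smul_sum_one_sub {ι A : Type*} [Fintype ι] [Nonempty ι] [Ring A] [Algebra ℂ A]
    (x : ι → A) : (Fintype.card ι : ℂ)⁻¹ • ∑ i, (1 - x i)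
      = 1 - (Fintype.card ι : ℂ)⁻¹ • ∑ i, x i := by
  rw [Finset.sum_sub_distrib, smul_sub, Finset.sum_const, Finset.card_univ,
    ← Nat.cast_smul_eq_nsmul ℂ, smul_smul,
    inv_mul_cancel₀ (Nat.cast_ne_zero.2 Fintype.card_ne_zero), one_smul]

/-- The global gauge transformation by `c` is the ribbon operator that transports the flux `c⁻¹`
along the boundary. -/
theorem elecBoundary_eq_elecRibbon {L : ℕ} (hL : 2 ≤ L) :
    elecBoundary G L = elecRibbon G L := by
  classical
  rw [elecBoundary_eq, sum_fullSector_boxElec, elecRibbon, inv_card_smul_sum_one_sub]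
  congr 2
  refine Finset.sum_congr rfl fun c _ => ?_
  have h := isShift_sum_ribbonOp (boundaryRibbon L) c⁻¹
  rw [prod_crossElt_boundaryRibbon hL] at h
  rw [(isShift_globalStarOp L c).eq h, chargeRibbonOp]
  simp

theorem sum_chargeRibbonOp_one (ρ : List Triangle) :
    ∑ χ : Dual G, chargeRibbonOp ρ χ 1 = (Fintype.card G : ℂ) • ribbonOp ρ (1 : G) 1 := by
  simp only [chargeRibbonOp, inv_one, conj_character]
  rw [Finset.sum_comm]
  simp only [← Finset.sum_smul, sum_dual_apply, inv_eq_one]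
  simp

/-- The sectors of the magnetic charges consist of the configurations with given monodromies. -/
theorem isDiag_fullSector_magCharge {ι : Type*} [Fintype ι] (m : ι → ℤ × ℤ) (κ : ι → G) :
    IsDiag (fullSector (fun s => magCharge (m s)) κ)
      fun σ => if (fun s => monodromy (m s) σ) = κ then 1 else 0 := by
  have h := IsDiag.list_prod (l := (Finset.univ : Finset ι).toList)
    fun s => isDiag_plaqOp (m s) (κ s)
  refine IsDiag.congr (x := fullSector (fun s => magCharge (m s)) κ) h fun σ => ?_
  rw [Finset.prod_map_toList, Finset.prod_ite_zero, Finset.prod_const_one]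
  refine if_congr ?_ rfl rfl
  rw [funext_iff]
  exact ⟨fun h f => h f (Finset.mem_univ f), fun h f _ => h f⟩

/-- By the discrete Stokes theorem, the projector onto trivial total magnetic charge is the
projection onto trivial holonomy along the boundary. -/
theorem sum_fullSector_boxMag (L : ℕ) :
    ∑ κ with ∏ f, κ f = 1, fullSector (boxMag (G := G) L) κ
      = ribbonOp (boundaryRibbon L) 1 1 := by
  refine IsDiag.eq (IsDiag.sum fun κ => isDiag_fullSector_magCharge Subtype.val κ)
    ((isDiag_ribbonOp_one _ _).congr fun σ => ?_)
  have h := Finset.prod_coe_sort (facesIn (box L)) fun f => monodromy f σ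
  simp only [prod_holonomy_boundaryRibbon, inv_eq_one, ← h]
  rw [Finset.sum_ite_eq]
  simp only [Finset.mem_filter, Finset.mem_univ, true_and]

theorem magBoundary_eq_magRibbon (L : ℕ) : magBoundary G L = magRibbon G L := by
  have h := inv_card_smul_sum_one_sub fun χ : Dual G => chargeRibbonOp (boundaryRibbon L) χ (1 : G)
  rw [sum_chargeRibbonOp_one, card_dual, smul_smul, inv_mul_cancel₀ card_cast_ne_zero,
    one_smul] at h
  rw [magBoundary_eq, sum_fullSector_boxMag]
  exact h.symm

theorem boundaryRibbon_bond_mem {L : ℕ} (hL : 2 ≤ L) :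
    ∀ τ ∈ boundaryRibbon L, τ.bond ∈ box L \ box (L - 1) := by
  intro τ hτ
  have hL' : ((L - 1 : ℕ) : ℤ) = L - 1 := by omega
  rw [Finset.mem_sdiff, mem_box, mem_box, hL']
  rw [boundaryRibbon_eq] at hτ
  simp only [List.mem_append, mem_ribbonSide] at hτ
  obtain ((⟨k, hk, ⟨_, rfl⟩ | rfl⟩ | ⟨k, hk, ⟨_, rfl⟩ | rfl⟩) | ⟨k, hk, ⟨_, rfl⟩ | rfl⟩) |
    ⟨k, hk, ⟨_, rfl⟩ | rfl⟩ := hτ <;>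
  simp only [Triangle.bond, Bond.tgt] <;> omega

theorem elecRibbon_mem {L : ℕ} (hL : 2 ≤ L) :
    elecRibbon G L ∈ localAlg G (box L \ box (L - 1)) :=
  SMulMemClass.smul_mem _ (sum_mem fun _ _ => sub_mem (one_mem _)
    (chargeRibbonOp_mem (boundaryRibbon_bond_mem hL) _ _))

theorem magRibbon_mem {L : ℕ} (hL : 2 ≤ L) :
    magRibbon G L ∈ localAlg G (box L \ box (L - 1)) :=
  SMulMemClass.smul_mem _ (sum_mem fun _ _ => sub_mem (one_mem _)
    (chargeRibbonOp_mem (boundaryRibbon_bond_mem hL) _ _))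

end BoundaryOperators

/-! ### Zero-energy states -/

section ZeroEnergy

open scoped MatrixOrder in
/-- The sum of two positive elements of a local algebra is positive; the square root is taken in the
matrix algebra, so that it is local as well. -/
theorem exists_star_mul_self_add {G : Type*} [Fintype G] [DecidableEq G] {Λ : Finset Bond}
    {a b : QLA G} (ha : a ∈ localAlg G Λ) (hb : b ∈ localAlg G Λ) :
    ∃ c ∈ localAlg G Λ, star a * a + star b * b = star c * c := by
  obtain ⟨M, rfl⟩ := ha
  obtain ⟨N, rfl⟩ := hb
  have h : 0 ≤ star M * M + star N * N :=
    add_nonneg (star_mul_self_nonneg M) (star_mul_self_nonneg N)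
  obtain ⟨X, hX, -, hX2⟩ := CFC.exists_sqrt_of_isSelfAdjoint_of_quasispectrumRestricts
    (IsSelfAdjoint.of_nonneg h) (QuasispectrumRestricts.nnreal_of_nonneg h)
  refine ⟨obs Λ X, obs_mem_localAlg Λ X, ?_⟩
  change star (obs Λ M) * obs Λ M + star (obs Λ N) * obs Λ N = star (obs Λ X) * obs Λ X
  rw [← map_star, ← map_star, ← map_star, ← map_mul, ← map_mul, ← map_mul, ← map_add, hX.star_eq,
    hX2]

theorem fullSector_mem {G ι C : Type*} [Fintype G] [DecidableEq G] [Fintype ι]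
    {P : ι → C → QLA G} {Λ : Finset Bond} (h : ∀ s c, P s c ∈ localAlg G Λ) (κ : ι → C) :
    fullSector P κ ∈ localAlg G Λ := by
  refine list_prod_mem fun x hx => ?_
  obtain ⟨s, _, rfl⟩ := List.mem_map.1 hx
  exact h _ _

theorem isPos_star_mul_self {A : Type*} [Ring A] [StarRing A] (b : A) : IsPos (star b * b) :=
  ⟨b, rfl⟩

theorem isState_restrictTo {G : Type*} [Fintype G] [DecidableEq G]
    {ω : QLA G →ₗ[ℂ] ℂ} (hω : IsState ω) (Λ : Finset Bond) :
    IsState (restrictTo Λ ω) := by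
  refine ⟨?_, hω.2⟩
  rintro _ ⟨b, rfl⟩
  exact hω.1 _ ⟨b, rfl⟩

theorem IsChargeFamily.exists_excessOp_eq {G ι C : Type*} [Fintype G] [DecidableEq G] [Fintype ι]
    [DecidableEq ι] [Fintype C] [DecidableEq C] [CommMonoid C] {P : ι → C → QLA G}
    (hP : IsChargeFamily P) {Λ : Finset Bond} (h : ∀ s c, P s c ∈ localAlg G Λ) :
    ∃ b ∈ localAlg G Λ, excessOp P = star b * b :=
  ⟨_, sum_mem fun κ _ => SMulMemClass.smul_mem _ (fullSector_mem h κ),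
    hP.excessOp_eq_star_mul_self⟩

variable {G : Type*} [CommGroup G] [Fintype G] [DecidableEq G]

variable (G) in
/-- The Hamiltonian with boundary terms is a positive element of the local algebra. -/
theorem exists_hamiltonian_sub_boundary_eq (L : ℕ) : ∃ b ∈ localAlg G (box L),
    hamiltonian G (box L) - elecBoundary G L - magBoundary G L = star b * b := by
  classical
  have hE := (isChargeFamily_boxElec (G := G) L).exists_excessOp_eq (Λ := box L)
    fun v χ => localAlg_mono (starBonds_subset v.2) (elecCharge_mem v.1 χ)
  have hM := (isChargeFamily_boxMag (G := G) L).exists_excessOp_eq (Λ := box L)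
    fun f c => localAlg_mono (plaquette_subset f.2) (plaqOp_mem f.1 c)
  obtain ⟨a, ha, hEa⟩ := hE
  obtain ⟨b, hb, hMb⟩ := hM
  rw [hamiltonian_sub_boundary, hEa, hMb]
  exact exists_star_mul_self_add ha hb

/-- In a ground state the Hamiltonian with boundary terms has zero energy, because there are no
pairs of charges. -/
theorem IsGroundState.map_hamiltonian_sub_boundary {ω : QLA G →ₗ[ℂ] ℂ} (hω : IsGroundState ω)
    (L : ℕ) : ω (hamiltonian G (box L) - elecBoundary G L - magBoundary G L) = 0 := by
  classical
  have hE := (isChargeFamily_boxElec (G := G) L).map_excessOp_eq_zero hω.1.1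
    fun v w χ κ hvw hχ hκ => hω.map_elecCharge_mul (Subtype.val_injective.ne hvw) hχ hκ
  have hM := (isChargeFamily_boxMag (G := G) L).map_excessOp_eq_zero hω.1.1
    fun p q c d hpq hc hd => hω.map_magCharge_mul (Subtype.val_injective.ne hpq) hc hd
  rw [hamiltonian_sub_boundary, map_add, hE, hM, add_zero]

/-- Interaction terms outside `Λ_{L+1}` do not contribute to the commutator with an observable
of `Λ_L`. -/
theorem commutator_hamiltonian_eq {L M : ℕ} (hM : L + 1 ≤ M) {A : QLA G}
    (hA : A ∈ localAlg G (box L)) :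
    hamiltonian G (box M) * A - A * hamiltonian G (box M)
      = hamiltonian G (box (L + 1)) * A - A * hamiltonian G (box (L + 1)) := by
  have hcomm : Commute (hamiltonian G (box M) - hamiltonian G (box (L + 1))) A := by
    have hs : starsIn (box (L + 1)) ⊆ starsIn (box M) := fun v hv => by
      rw [mem_starsIn_box] at hv ⊢
      omega
    have hf : facesIn (box (L + 1)) ⊆ facesIn (box M) := fun f hf => by
      rw [mem_facesIn_box] at hf ⊢
      omega
    rw [hamiltonian_eq, hamiltonian_eq, add_sub_add_comm, ← Finset.sum_sdiff hs,
      ← Finset.sum_sdiff hf, add_sub_cancel_right, add_sub_cancel_right]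
    refine Commute.add_left (Commute.sum_left _ _ _ fun v hv => ?_)
      (Commute.sum_left _ _ _ fun f hf => ?_)
    · exact (Commute.one_left _).sub_left (commute_of_disjoint
        (disjoint_starBonds_box (Finset.mem_sdiff.1 hv).2) (elecCharge_mem v 1) hA)
    · exact (Commute.one_left _).sub_left (commute_of_disjoint
        (disjoint_plaquette_box (Finset.mem_sdiff.1 hf).2) (plaqOp_mem f 1) hA)
  have h := hcomm.eq
  rw [sub_mul, mul_sub] at h
  rw [sub_eq_sub_iff_sub_eq_sub]
  exact h

/-- The boundary terms commute with the observables inside the boundary; if the Hamiltonian with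
boundary terms has zero energy, only `(b A)* (b A)` contributes, where `b* b` is this
Hamiltonian. -/
theorem map_star_mul_commutator_nonneg {ω : QLA G →ₗ[ℂ] ℂ} (hω : IsState ω) {L : ℕ} (hL : 1 ≤ L)
    (h : ω (hamiltonian G (box (L + 1)) - elecBoundary G (L + 1) - magBoundary G (L + 1)) = 0)
    {A : QLA G} (hA : A ∈ localAlg G (box L)) :
    0 ≤ ω (star A * (hamiltonian G (box (L + 1)) * A - A * hamiltonian G (box (L + 1)))) := by
  have hdisj : Disjoint (box (L + 1) \ box L) (box L) := Finset.sdiff_disjoint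
  have hE : Commute (elecBoundary G (L + 1)) A :=
    commute_of_disjoint hdisj (by
      rw [elecBoundary_eq_elecRibbon (by omega)]
      exact elecRibbon_mem (L := L + 1) (by omega)) hA
  have hM : Commute (magBoundary G (L + 1)) A :=
    commute_of_disjoint hdisj (by
      rw [magBoundary_eq_magRibbon]
      exact magRibbon_mem (L := L + 1) (by omega)) hA
  have hpos := exists_hamiltonian_sub_boundary_eq G (L + 1)
  obtain ⟨b, -, hb⟩ := hpos
  have h0 : ω (star b * b) = 0 := by
    rw [← hb]
    exact h
  have hB : hamiltonian G (box (L + 1)) * A - A * hamiltonian G (box (L + 1))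
      = star b * b * A - A * (star b * b) := by
    rw [← hb]
    simp only [sub_mul, mul_sub, hE.eq, hM.eq]
    abel
  have e : star A * (star b * b * A - A * (star b * b))
      = star (b * A) * (b * A) - star A * A * star b * b := by
    rw [star_mul]
    noncomm_ring
  rw [hB, e, map_sub, map_mul_eq_zero hω.1 h0, sub_zero]
  exact hω.1 _ (isPos_star_mul_self (b * A))

/-- On local observables the generator is the commutator with a finite-volume Hamiltonian. -/
theorem map_star_mul_nonneg_of_tendsto {ω : QLA G →ₗ[ℂ] ℂ} (hω : IsState ω)
    (h : ∀ L : ℕ, 2 ≤ L → ω (hamiltonian G (box L) - elecBoundary G L - magBoundary G L) = 0)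
    {Λ : Finset Bond} {A B : QLA G} (hA : A ∈ localAlg G Λ)
    (hlim : Tendsto (fun L : ℕ => hamiltonian G (box L) * A - A * hamiltonian G (box L)) atTop
      (𝓝 B)) :
    0 ≤ ω (star A * B) := by
  have hex := ((eventually_subset_box Λ).and (eventually_ge_atTop 1)).exists
  obtain ⟨L, hΛ, hL⟩ := hex
  have hA' : A ∈ localAlg G (box L) := localAlg_mono hΛ hA
  have hev : (fun M : ℕ => hamiltonian G (box M) * A - A * hamiltonian G (box M)) =ᶠ[atTop]
      fun _ => hamiltonian G (box (L + 1)) * A - A * hamiltonian G (box (L + 1)) := by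
    filter_upwards [eventually_ge_atTop (L + 1)] with M hM
    exact commutator_hamiltonian_eq hM hA'
  have hB : B = hamiltonian G (box (L + 1)) * A - A * hamiltonian G (box (L + 1)) :=
    tendsto_nhds_unique hlim (tendsto_const_nhds.congr' hev.symm)
  rw [hB]
  exact map_star_mul_commutator_nonneg hω hL (h (L + 1) (by omega)) hA'

theorem isClosed_setOf_nonneg {X : Type*} [TopologicalSpace X] {F : X → ℂ}
    (hF : Continuous F) : IsClosed {p | 0 ≤ F p} :=
  isClosed_le continuous_const hF

theorem isClosed_setOf_map_star_mul_nonneg {G : Type*} [Fintype G] [DecidableEq G]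
    {ω : QLA G →ₗ[ℂ] ℂ} (hω : IsState ω) :
    IsClosed {p : QLA G × QLA G | 0 ≤ ω (star p.1 * p.2)} := by
  have hc : Continuous fun p : QLA G × QLA G => ω (star p.1 * p.2) := by
    have hω' := continuous_of_isState hω
    have hmul : Continuous fun p : QLA G × QLA G => star p.1 * p.2 := by fun_prop
    exact hω'.comp hmul
  have hclosed := isClosed_setOf_nonneg hc
  exact hclosed

theorem generatorGraph_subset {ω : QLA G →ₗ[ℂ] ℂ} (hω : IsState ω)
    (h : ∀ L : ℕ, 2 ≤ L → ω (hamiltonian G (box L) - elecBoundary G L - magBoundary G L) = 0) :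
    generatorGraph G ⊆ {p : QLA G × QLA G | 0 ≤ ω (star p.1 * p.2)} := by
  refine closure_minimal (fun p hp => ?_) (isClosed_setOf_map_star_mul_nonneg hω)
  rw [Set.mem_ofPred_eq] at hp ⊢
  have h1 := hp.1
  obtain ⟨Λ, hA⟩ := h1
  exact map_star_mul_nonneg_of_tendsto hω h hA hp.2

/-- States of zero energy for the Hamiltonians with boundary terms are ground states. -/
theorem isGroundState_of_forall_eq_zero {ω : QLA G →ₗ[ℂ] ℂ} (hω : IsState ω)
    (h : ∀ L : ℕ, 2 ≤ L → ω (hamiltonian G (box L) - elecBoundary G L - magBoundary G L) = 0) :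
    IsGroundState ω := by
  refine ⟨hω, fun A δA hA => ?_⟩
  have h' := generatorGraph_subset hω h hA
  rw [Set.mem_ofPred_eq] at h'
  exact h'

theorem boundaryHamiltonian_eq {L : ℕ} (hL : 2 ≤ L) : boundaryHamiltonian G L
    = hamiltonian G (box L) - elecBoundary G L - magBoundary G L := by
  rw [boundaryHamiltonian, elecBoundary_eq_elecRibbon hL, magBoundary_eq_magRibbon]

end ZeroEnergy

end QuantumDouble

end

theorem mainTheorem3 {G : Type*} [CommGroup G] [Fintype G] [DecidableEq G] :
    -- infinite-volume ground states are the states of zero energy for the boundary condition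
    (∀ ω : QuantumDouble.QLA G →ₗ[ℂ] ℂ, QuantumDouble.IsState ω →
      (QuantumDouble.IsGroundState ω ↔ ∀ L : ℕ, 2 ≤ L →
        ω (QuantumDouble.hamiltonian G (QuantumDouble.box L) - QuantumDouble.elecBoundary G L
          - QuantumDouble.magBoundary G L) = 0)) ∧
    -- the boundary terms are given by the closed ribbon along the boundary
    (∀ L : ℕ, 2 ≤ L →
      QuantumDouble.IsClosedRibbon (QuantumDouble.boundaryRibbon L) ∧
      QuantumDouble.elecBoundary G L = QuantumDouble.elecRibbon G L ∧
      QuantumDouble.magBoundary G L = QuantumDouble.magRibbon G L ∧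
      QuantumDouble.elecRibbon G L ∈
        QuantumDouble.localAlg G (QuantumDouble.box L \ QuantumDouble.box (L - 1)) ∧
      QuantumDouble.magRibbon G L ∈
        QuantumDouble.localAlg G (QuantumDouble.box L \ QuantumDouble.box (L - 1))) ∧
    -- the Hamiltonian with the boundary condition is a positive element of the local algebra, and
    -- every ground state restricts to a state of zero energy for it
    (∀ L : ℕ, 2 ≤ L →
      (∃ H : QuantumDouble.localAlg G (QuantumDouble.box L),
        (H : QuantumDouble.QLA G) = QuantumDouble.boundaryHamiltonian G L ∧
          QuantumDouble.IsPos H) ∧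
      ∀ ω : QuantumDouble.QLA G →ₗ[ℂ] ℂ, QuantumDouble.IsGroundState ω →
        QuantumDouble.restrictTo (QuantumDouble.box L) ω ∈
          QuantumDouble.zeroEnergyStates G L) := by
  refine ⟨fun ω hω => ⟨fun h L _ => h.map_hamiltonian_sub_boundary L,
      QuantumDouble.isGroundState_of_forall_eq_zero hω⟩, fun L hL => ?_, fun L hL => ⟨?_, ?_⟩⟩
  · exact ⟨QuantumDouble.isClosedRibbon_boundaryRibbon hL,
      QuantumDouble.elecBoundary_eq_elecRibbon hL, QuantumDouble.magBoundary_eq_magRibbon L,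
      QuantumDouble.elecRibbon_mem hL, QuantumDouble.magRibbon_mem hL⟩
  · have hpos := QuantumDouble.exists_hamiltonian_sub_boundary_eq G L
    obtain ⟨b, hb, h⟩ := hpos
    refine ⟨_, ?_, QuantumDouble.isPos_star_mul_self ⟨b, hb⟩⟩
    rw [QuantumDouble.boundaryHamiltonian_eq hL]
    exact h.symm
  · intro ω hω
    rw [QuantumDouble.zeroEnergyStates, Set.mem_ofPred_eq]
    refine ⟨QuantumDouble.isState_restrictTo hω.1 _, fun H hH => ?_⟩
    change ω H = 0
    rw [hH, QuantumDouble.boundaryHamiltonian_eq hL]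
    exact hω.map_hamiltonian_sub_boundary L
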